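/- Let $\widehat{\mathbb Z}$ be the ring of profinite integers and $\widehat F_2$ the free profinite group on $x,y$; for $f\in\widehat F_2$ and elements $a,b$ of a profinite group $G$, write $f(a,b)$ for the image of $f$ under the continuous homomorphism $\widehat F_2\to G$, $x\mapsto a$, $y\mapsto b$. The profinite Grothendieck–Teichmüller group $\widehat{GT}$ is the set of pairs $(\lambda,f)$ with $\lambda\in\widehat{\mathbb Z}^{\times}$ and $f$ in the closed derived subgroup of $\widehat F_2$ such that $x\mapsto x^\lambda$, $y\mapsto f^{-1}y^\lambda f$ extends to an automorphism of $\widehat F_2$ and (I) $f(x,y)f(y,x)=1$; (II) $f(x,y)x^m f(z,x)z^m f(y,z)y^m=1$ whenever $xyz=1$, where $m=(\lambda-1)/2\in\widehat{\mathbb Z}$; (III) $f(x_{12},x_{23})f(x_{34},x_{45})f(x_{51},x_{12})f(x_{23},x_{34})f(x_{45},x_{51})=1$ in the profinite completion of the pure mapping class group $\Gamma_{0,5}$ of the sphere with five marked points, where $x_{i,i+1}$ (indices mod $5$) is the standard generator, the twist around the points $i$ and $i+1$. Let $n\ge 4$ and let $\widehat B_n$ be the profinite completion of the Artin braid group with generators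 $a_1,\dots,a_{n-1}$ and relations $a_ia_j=a_ja_i$ for $|i-j|>1$, $a_ia_{i+1}a_i=a_{i+1}a_ia_{i+1}$ for $1\le i\le n-2$. Put $y_k=a_{k-1}\cdots a_2a_1^2a_2\cdots a_{k-1}$ for $2\le k\le n$, put $t_i=a_{2i}a_{2i+1}a_{2i-1}a_{2i}$ for $i\ge1$ with $2i+1\le n-1$, and for $i\ge2$ put $W_i=(t_1\cdots t_{i-1})^i$. Let $(\lambda,f)\in\widehat{GT}$. Then there is exactly one continuous automorphism $F$ of $\widehat B_n$ with $$F(a_1)=a_1^\lambda,\qquad F(a_i)=f(a_i^2,y_i)\,a_i^\lambda\,f(y_i,a_i^2)\quad(2\le i\le n-1)$$ (Drinfeld's action). Let $F_{\mathcal B}=\mathrm{inn}\bigl(\prod_{j\ge1,\ 2j+1\le n-1}f(y_{2j+1},a_{2j+1}^2)\bigr)\circ F$, where $\mathrm{inn}(c)(u)=cuc^{-1}$ and the product is taken in increasing order of $j$. Then: 1. $F_{\mathcal B}(t_1)=t_1^\lambda$; 2. if $n\ge 6$, then $F_{\mathcal B}(t_2)=f(t_2^2,t_1^2)\,t_2^\lambda\,f(t_1^2,t_2^2)$;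 3. for every $i\ge 2$ with $2i+2\le n$, $F_{\mathcal B}(t_i)=f(t_i^2,W_i)\,t_i^\lambda\,f(W_i,t_i^2)$. -/

import Mathlib

open ProfiniteGrp

noncomputable section

namespace GTBraid

/-! ### Profinite completions and evaluation of profinite words -/

/-- The profinite completion of a group `G`. -/
abbrev Hat (G : Type) [Group G] : ProfiniteGrp.{0} :=
  ProfiniteCompletion.completion (GrpCat.of G)

/-- The canonical homomorphism from `G` to its profinite completion. -/
def toHat (G : Type) [Group G] : G →* Hat G :=
  (ProfiniteCompletion.eta (GrpCat.of G)).hom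

/-- The continuous extension to the profinite completion of `G` of a homomorphism from `G` to a
profinite group. -/
def extend {G : Type} [Group G] (P : ProfiniteGrp.{0}) (φ : G →* P) : Hat G →ₜ* P :=
  (ProfiniteCompletion.lift (GrpCat.ofHom φ)).hom

/-- The free profinite group on two generators. -/
abbrev FreeTwoHat : ProfiniteGrp.{0} := Hat (FreeGroup (Fin 2))

/-- The first generator of the free profinite group on two generators. -/
def genX : FreeTwoHat := toHat (FreeGroup (Fin 2)) (FreeGroup.of 0)

/-- The second generator of the free profinite group on two generators. -/
def genY : FreeTwoHat := toHat (FreeGroup (Fin 2)) (FreeGroup.of 1)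

/-- `ev f a b` is `f(a, b)`: the image of `f` under the continuous homomorphism from the free
profinite group on `x, y` with `x ↦ a` and `y ↦ b`. -/
def ev {P : ProfiniteGrp.{0}} (f : FreeTwoHat) (a b : P) : P :=
  extend P (FreeGroup.lift ![a, b]) f

/-! ### The ring of profinite integers and profinite powers -/

/-- The ring of profinite integers: compatible families of residue classes. -/
def ZHat : Subring ((n : ℕ+) → ZMod (n : ℕ)) where
  carrier := {x | ∀ (m n : ℕ+) (h : (m : ℕ) ∣ (n : ℕ)),
    ZMod.castHom h (ZMod (m : ℕ)) (x n) = x m}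
  mul_mem' := fun ha hb m n h => by
    rw [Pi.mul_apply, Pi.mul_apply, map_mul, ha m n h, hb m n h]
  one_mem' := fun m n h => by rw [Pi.one_apply, Pi.one_apply, map_one]
  add_mem' := fun ha hb m n h => by
    rw [Pi.add_apply, Pi.add_apply, map_add, ha m n h, hb m n h]
  zero_mem' := fun m n h => by rw [Pi.zero_apply, Pi.zero_apply, map_zero]
  neg_mem' := fun ha m n h => by
    rw [Pi.neg_apply, Pi.neg_apply, map_neg, ha m n h]

/-- The index of a finite-index subgroup of the infinite cyclic group. -/
def zIndex (H : FiniteIndexNormalSubgroup (GrpCat.of (Multiplicative ℤ))) : ℕ+ :=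
  ⟨H.toSubgroup.index, Nat.pos_of_ne_zero Subgroup.FiniteIndex.index_ne_zero⟩

theorem mem_of_index_dvd {L : Subgroup (Multiplicative ℤ)} {u v c : ℤ}
    (h : v - u = (L.index : ℤ) * c) :
    (Multiplicative.ofAdd u)⁻¹ * Multiplicative.ofAdd v ∈ L := by
  have hpow := L.zpow_mem (Subgroup.pow_index_mem L (Multiplicative.ofAdd (1 : ℤ))) c
  rw [← ofAdd_nsmul, ← ofAdd_zsmul] at hpow
  rw [← ofAdd_neg, ← ofAdd_add, neg_add_eq_sub, h]
  convert hpow using 2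
  rw [smul_eq_mul, nsmul_eq_mul, mul_one, mul_comm]

/-- A profinite integer, as an element of the profinite completion of the infinite cyclic group:
its component in the quotient by the subgroup of index `n` is its residue class modulo `n`. -/
def toCyclic (l : ZHat) : Hat (Multiplicative ℤ) :=
  ⟨fun H => QuotientGroup.mk
      (Multiplicative.ofAdd (((l : (n : ℕ+) → ZMod (n : ℕ)) (zIndex H)).val : ℤ)), by
    intro H K h
    have hle : H.toSubgroup ≤ K.toSubgroup := h.le
    have hdvd : K.toSubgroup.index ∣ H.toSubgroup.index := Subgroup.index_dvd_of_le hle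
    have hc := l.2 (zIndex K) (zIndex H) hdvd
    have hc : ZMod.cast ((l : (n : ℕ+) → ZMod (n : ℕ)) (zIndex H)) =
        (l : (n : ℕ+) → ZMod (n : ℕ)) (zIndex K) := hc
    have hmod : (((l : (n : ℕ+) → ZMod (n : ℕ)) (zIndex K)).val : ℤ) ≡
        (((l : (n : ℕ+) → ZMod (n : ℕ)) (zIndex H)).val : ℤ) [ZMOD (zIndex K : ℕ)] := by
      rw [← ZMod.intCast_eq_intCast_iff, Int.cast_natCast, Int.cast_natCast,
        ZMod.natCast_zmod_val, ZMod.natCast_val]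
      exact hc.symm
    obtain ⟨c, hcc⟩ := hmod.dvd
    exact Eq.symm ((QuotientGroup.eq (s := K.toSubgroup)).mpr
      (mem_of_index_dvd (L := K.toSubgroup) hcc))⟩

/-- `l`-th power of an element of a profinite group, `l` a profinite integer: the image of `l`
under the continuous homomorphism from the profinite integers with `1 ↦ a`. -/
def ppow {P : ProfiniteGrp.{0}} (a : P) (l : ZHat) : P :=
  extend P (zpowersHom P a) (toCyclic l)

/-! ### The pure mapping class group of the sphere with five marked points -/

/-- Generators `A i j` (`1 ≤ i < j ≤ 4`) of the pure braid group on four strands; `A i j` is the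
full twist of the strands `i` and `j`. -/
inductive PureGen : Type
  | A12 | A13 | A14 | A23 | A24 | A34

open FreeGroup PureGen in
/-- The pure mapping class group of the sphere with five marked points, as the pure braid group
on four strands modulo its centre. In terms of the standard generators of the braid group,
`A i j` is `σ_{j-1} ⋯ σ_{i+1} σ_i² σ_{i+1}⁻¹ ⋯ σ_{j-1}⁻¹`. The first eleven relators present the
pure braid group: for each `i < j < k` the products `A i j * A i k * A j k`, `A i k * A j k * A i j`
and `A j k * A i j * A i k` agree, and there are three commutation relations. The last relator is
the full twist on all strands, which generates the centre. -/
def pureRels : Set (FreeGroup PureGen) :=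
  { of A12 * of A13 * of A23 * (of A13 * of A23 * of A12)⁻¹,
    of A12 * of A13 * of A23 * (of A23 * of A12 * of A13)⁻¹,
    of A12 * of A14 * of A24 * (of A14 * of A24 * of A12)⁻¹,
    of A12 * of A14 * of A24 * (of A24 * of A12 * of A14)⁻¹,
    of A13 * of A14 * of A34 * (of A14 * of A34 * of A13)⁻¹,
    of A13 * of A14 * of A34 * (of A34 * of A13 * of A14)⁻¹,
    of A23 * of A24 * of A34 * (of A24 * of A34 * of A23)⁻¹,
    of A23 * of A24 * of A34 * (of A34 * of A23 * of A24)⁻¹,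
    of A12 * of A34 * (of A34 * of A12)⁻¹,
    of A14 * of A23 * (of A23 * of A14)⁻¹,
    of A13 * ((of A34)⁻¹ * of A24 * of A34) *
      ((of A34)⁻¹ * of A24 * of A34 * of A13)⁻¹,
    of A12 * of A13 * of A23 * of A14 * of A24 * of A34 }

/-- The pure mapping class group of the sphere with five marked points. -/
abbrev Gamma05 : Type := PresentedGroup pureRels

/-- The image of a generator in the profinite completion of `Gamma05`. -/
def pg (s : PureGen) : Hat Gamma05 := toHat Gamma05 (PresentedGroup.of s)

/-- The twist around the points `1, 2`. -/
def x12 : Hat Gamma05 := pg .A12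

/-- The twist around the points `2, 3`. -/
def x23 : Hat Gamma05 := pg .A23

/-- The twist around the points `3, 4`. -/
def x34 : Hat Gamma05 := pg .A34

/-- The twist around the points `4, 5`: on the sphere, the full twist of `1, 2, 3`. -/
def x45 : Hat Gamma05 := pg .A12 * pg .A13 * pg .A23

/-- The twist around the points `5, 1`: on the sphere, the full twist of `2, 3, 4`. -/
def x51 : Hat Gamma05 := pg .A23 * pg .A24 * pg .A34

/-! ### The Grothendieck-Teichmüller group -/

/-- Elements of the profinite Grothendieck-Teichmüller group: pairs `(l, f)`, where `l` is a unit
of the ring of profinite integers and `f` lies in the (closed) derived subgroup of the free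
profinite group on `x, y`, such that `x ↦ x^l`, `y ↦ f⁻¹ y^l f` extends to an automorphism and the
three defining relations hold. -/
structure GTHat where
  /-- The cyclotomic component. -/
  l : ZHat
  /-- The pro-word in two variables. -/
  f : FreeTwoHat
  isUnit_l : IsUnit l
  f_mem : f ∈ (commutator FreeTwoHat).topologicalClosure
  /-- The induced endomorphism of the free profinite group is invertible. -/
  exists_aut : ∃ φ : FreeTwoHat ≃ₜ* FreeTwoHat,
    φ genX = ppow genX l ∧ φ genY = f⁻¹ * ppow genY l * f
  /-- Relation (I). -/
  relI : ev f genX genY * ev f genY genX = 1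
  /-- Relation (II), with `m = (l - 1) / 2` and `x y z = 1`. -/
  relII : ∃ m : ZHat, l = 2 * m + 1 ∧ ∀ z : FreeTwoHat, genX * genY * z = 1 →
    ev f genX genY * ppow genX m * ev f z genX * ppow z m * ev f genY z * ppow genY m = 1
  /-- Relation (III), the pentagon. -/
  relIII : ev f x12 x23 * ev f x34 x45 * ev f x51 x12 * ev f x23 x34 * ev f x45 x51 = 1

/-! ### The profinite braid group and the elements of the statement -/

/-- The relators of the Artin braid group on `n` strands, generated by `a_1, …, a_{n-1}`. -/
def braidRels (n : ℕ) : Set (FreeGroup (Set.Ico 1 n)) :=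
  {r | ∃ i j : Set.Ico 1 n, (i : ℕ) + 1 < j ∧
      r = FreeGroup.of i * FreeGroup.of j * (FreeGroup.of j * FreeGroup.of i)⁻¹} ∪
  {r | ∃ i j : Set.Ico 1 n, (i : ℕ) + 1 = j ∧
      r = FreeGroup.of i * FreeGroup.of j * FreeGroup.of i *
        (FreeGroup.of j * FreeGroup.of i * FreeGroup.of j)⁻¹}

/-- The Artin braid group on `n` strands. -/
abbrev Braid (n : ℕ) : Type := PresentedGroup (braidRels n)

/-- The profinite braid group on `n` strands. -/
abbrev BraidHat (n : ℕ) : ProfiniteGrp.{0} := Hat (Braid n)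

/-- The generator `a_i`, for `1 ≤ i ≤ n - 1` (and `1` for other values of `i`, never used). -/
def a (n i : ℕ) : BraidHat n :=
  if h : i ∈ Set.Ico 1 n then toHat (Braid n) (PresentedGroup.of ⟨i, h⟩) else 1

/-- `y_k = a_{k-1} ⋯ a_2 a_1² a_2 ⋯ a_{k-1}`, for `2 ≤ k ≤ n`. -/
def y (n : ℕ) : ℕ → BraidHat n
  | 0 => 1
  | 1 => 1
  | k + 2 => a n (k + 1) * y n (k + 1) * a n (k + 1)

/-- `t_i = a_{2i} a_{2i+1} a_{2i-1} a_{2i}`, for `1 ≤ i` and `2i + 1 ≤ n - 1`. -/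
def t (n i : ℕ) : BraidHat n :=
  a n (2 * i) * a n (2 * i + 1) * a n (2 * i - 1) * a n (2 * i)

/-- `W_i = (t_1 ⋯ t_{i-1})^i`. -/
def W (n i : ℕ) : BraidHat n :=
  ((List.range (i - 1)).map fun j => t n (j + 1)).prod ^ i

/-- `F` is the action of `(l, f)` on the profinite braid group: `F(a_1) = a_1^l` and
`F(a_i) = f(a_i², y_i) a_i^l f(y_i, a_i²)` for `2 ≤ i ≤ n - 1`. -/
def IsDrinfeldAction (g : GTHat) (n : ℕ) (F : BraidHat n ≃ₜ* BraidHat n) : Prop :=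
  F (a n 1) = ppow (a n 1) g.l ∧
  ∀ i : ℕ, 2 ≤ i → i ≤ n - 1 →
    F (a n i) = ev g.f (a n i ^ 2) (y n i) * ppow (a n i) g.l * ev g.f (y n i) (a n i ^ 2)

/-- The inner automorphism `x ↦ c x c⁻¹`. -/
def inn {P : ProfiniteGrp.{0}} (c : P) : P ≃ₜ* P where
  toMulEquiv := MulAut.conj c
  continuous_toFun := by
    change Continuous fun x : P => c * x * c⁻¹
    fun_prop
  continuous_invFun := by
    change Continuous fun x : P => c⁻¹ * x * c
    fun_prop

/-- The product of the `f(y_{2j+1}, a_{2j+1}²)` over all `j ≥ 1` with `2j + 1 ≤ n - 1`, in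
increasing order of `j`. -/
def twistProd (g : GTHat) (n : ℕ) : BraidHat n :=
  ((List.range (n / 2 - 1)).map fun k =>
    ev g.f (y n (2 * (k + 1) + 1)) (a n (2 * (k + 1) + 1) ^ 2)).prod

/-- The automorphism `F_B = inn(∏ f(y_{2j+1}, a_{2j+1}²)) ∘ F`. -/
def FB (g : GTHat) (n : ℕ) (F : BraidHat n ≃ₜ* BraidHat n) : BraidHat n ≃ₜ* BraidHat n :=
  F.trans (inn (twistProd g n))

end GTBraid

end

noncomputable section

namespace GTBraid

/-! ### Continuous homomorphisms from profinite completions -/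

section Completion

variable {G : Type} [Group G] {P Q : ProfiniteGrp.{0}}

/-! Write λ for `g.l` and m = (λ-1)/2. Three properties of f carry everything. Since f lies in the
closed derived subgroup, it is trivial on commuting pairs (`ev_eq_one`), so a factor commuting with
both arguments may be dropped from either one (`ev_mul_left`, `ev_mul_right`). Hence the hexagon
holds for p q r = w with w commuting with p, q, r, up to w^m (`hexagon`), and the pentagon holds for
images of Γ_{0,5} in any profinite group (`pentagon`).

Drinfeld's action. Put D(z,b) = f(b²,z) b^λ f(z,b²), so F(a_i) = D(y_i,a_i). The hexagon gives D z^λ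
D = (bzb)^λ, hence F(y_i) = y_i^λ. The pentagon supplies one element conjugating D(y_i,a_i),
D(y_{i+1},a_{i+1}) to the case of three strands, where the hexagon proves the braid relation
(`Triple.dr_braid`). The image of F contains every f(y_i,a_i²), because F restricts along x ↦ y_i, y
↦ a_i² to the given automorphism of the free group. Hence it contains a_i^λ and a_i, so F is onto,
and a surjective endomorphism of a topologically finitely generated profinite group is injective.

Bands. t_i = bcab crosses two bands of two strands, with a, b, c consecutive generators. F(t_i)
regroups into two products in which one strand passes two others. Three pentagons and one hexagon
turn the result, conjugated by the two neighbouring factors of the twist product, into f(t²,Y) t^λ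
f(Y,t²), where Y is the twist of the i-th band around the preceding strands (`Quad.dr_band`). The
remaining factors of the twist product have no effect. Finally the t_i satisfy the braid relations,
so W_i = W_{i-1} Y with W_{i-1} commuting with t_i and Y. Thus Y may be replaced by W_i. -/

theorem denseRange_toHat : DenseRange (toHat G) :=
  ProfiniteCompletion.denseRange (GrpCat.of G)

@[simp]
theorem extend_toHat (φ : G →* P) (x : G) : extend P φ (toHat G x) = φ x :=
  CategoryTheory.ConcreteCategory.congr_hom (ProfiniteCompletion.lift_eta (GrpCat.ofHom φ)) x

theorem hat_hom_ext {φ ψ : Hat G →ₜ* P} (h : ∀ x, φ (toHat G x) = ψ (toHat G x)) (u : Hat G) :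
    φ u = ψ u :=
  congrFun (denseRange_toHat.equalizer φ.continuous_toFun ψ.continuous_toFun (funext h)) u

theorem map_extend (ψ : P →ₜ* Q) (φ : G →* P) (u : Hat G) :
    ψ (extend P φ u) = extend Q ((ψ : P →* Q).comp φ) u :=
  hat_hom_ext (φ := ψ.comp (extend P φ)) (fun x => by simp) u

theorem map_ev (ψ : P →ₜ* Q) (f : FreeTwoHat) (u v : P) : ψ (ev f u v) = ev f (ψ u) (ψ v) := by
  rw [ev, map_extend, ev]
  congr 2
  ext i
  fin_cases i <;> simp

theorem map_ppow (ψ : P →ₜ* Q) (u : P) (l : ZHat) : ψ (ppow u l) = ppow (ψ u) l := by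
  rw [ppow, map_extend, ppow]
  congr 2
  ext
  simp

@[simp]
theorem ev_genX (u v : P) : ev genX u v = u := by simp [ev, genX]

@[simp]
theorem ev_genY (u v : P) : ev genY u v = v := by simp [ev, genY]

/-- Conjugation as a continuous endomorphism. -/
theorem conj_ev (c : P) (f : FreeTwoHat) (u v : P) :
    c * ev f u v * c⁻¹ = ev f (c * u * c⁻¹) (c * v * c⁻¹) :=
  map_ev (inn c : P →ₜ* P) f u v

theorem conj_ppow (c u : P) (l : ZHat) : c * ppow u l * c⁻¹ = ppow (c * u * c⁻¹) l :=
  map_ppow (inn c : P →ₜ* P) u l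

theorem semiconjBy_ev {c u v u' v' : P} (f : FreeTwoHat) (hu : SemiconjBy c u u')
    (hv : SemiconjBy c v v') : SemiconjBy c (ev f u v) (ev f u' v') := by
  rw [SemiconjBy, ← mul_inv_eq_iff_eq_mul, conj_ev, mul_inv_eq_iff_eq_mul.2 hu.eq,
    mul_inv_eq_iff_eq_mul.2 hv.eq]

theorem semiconjBy_ppow {c u u' : P} (l : ZHat) (hu : SemiconjBy c u u') :
    SemiconjBy c (ppow u l) (ppow u' l) := by
  rw [SemiconjBy, ← mul_inv_eq_iff_eq_mul, conj_ppow, mul_inv_eq_iff_eq_mul.2 hu.eq]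

theorem commute_ev {c u v : P} (f : FreeTwoHat) (hu : Commute c u) (hv : Commute c v) :
    Commute c (ev f u v) :=
  semiconjBy_ev f hu hv

theorem commute_ppow {c u : P} (l : ZHat) (hu : Commute c u) : Commute c (ppow u l) :=
  semiconjBy_ppow l hu

theorem ppow_comm {u v : P} (h : Commute u v) (l m : ZHat) :
    Commute (ppow u l) (ppow v m) :=
  commute_ppow m (commute_ppow l h.symm).symm

/-! ### Powers with profinite exponents -/

/-- The component of an element of the profinite completion in a finite quotient. -/
def component (H : FiniteIndexNormalSubgroup (GrpCat.of G)) :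
    Hat G →ₜ* (ProfiniteCompletion.diagram (GrpCat.of G)).obj H :=
  ((limitCone (ProfiniteCompletion.diagram (GrpCat.of G))).π.app H).hom

theorem hat_ext {u v : Hat G} (h : ∀ H, component H u = component H v) : u = v :=
  limit_ext _ u v h

theorem component_toCyclic_eq_iff (H : FiniteIndexNormalSubgroup (GrpCat.of (Multiplicative ℤ)))
    (l : ZHat) {k : ℤ} (h : ((l : (n : ℕ+) → ZMod n) (zIndex H)) = (k : ZMod (zIndex H))) :
    component H (toCyclic l) = component H (toHat (Multiplicative ℤ) (Multiplicative.ofAdd k)) := by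
  have h : ((((l : (n : ℕ+) → ZMod n) (zIndex H)).val : ℕ) : ℤ) ≡ k [ZMOD (zIndex H : ℕ)] := by
    rw [← ZMod.intCast_eq_intCast_iff, ← h]
    simp
  obtain ⟨c, hc⟩ := h.dvd
  exact (QuotientGroup.eq (s := H.toSubgroup)).2 (mem_of_index_dvd (L := H.toSubgroup) hc)

theorem component_toCyclic (H : FiniteIndexNormalSubgroup (GrpCat.of (Multiplicative ℤ)))
    (l : ZHat) : component H (toCyclic l) = component H (toHat (Multiplicative ℤ)
      (Multiplicative.ofAdd (((l : (n : ℕ+) → ZMod n) (zIndex H)).val : ℤ))) :=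
  component_toCyclic_eq_iff H l (by simp)

theorem toCyclic_add (l m : ZHat) : toCyclic (l + m) = toCyclic l * toCyclic m := by
  refine hat_ext fun H => ?_
  rw [map_mul, component_toCyclic H l, component_toCyclic H m, ← map_mul, ← map_mul, ← ofAdd_add]
  exact component_toCyclic_eq_iff H _ (by simp)

theorem toCyclic_one : toCyclic 1 = toHat (Multiplicative ℤ) (Multiplicative.ofAdd 1) :=
  hat_ext fun H => component_toCyclic_eq_iff H _ (by simp)

theorem ppow_add (u : P) (l m : ZHat) : ppow u (l + m) = ppow u l * ppow u m := by
  rw [ppow, toCyclic_add, map_mul]; rfl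

@[simp]
theorem ppow_one (u : P) : ppow u 1 = u := by
  simp [ppow, toCyclic_one]

theorem commute_self_ppow (u : P) (l : ZHat) : Commute u (ppow u l) :=
  commute_ppow l (Commute.refl u)

theorem commute_extend {φ ψ : G →* P} (h : ∀ x y, Commute (φ x) (ψ y)) (u v : Hat G) :
    Commute (extend P φ u) (extend P ψ v) := by
  have key : ∀ (c : P) (χ : G →* P), (∀ x, Commute c (χ x)) → ∀ w, Commute c (extend P χ w) := by
    intro c χ hc w
    have := hat_hom_ext (φ := (inn c : P →ₜ* P).comp (extend P χ)) (ψ := extend P χ)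
      (fun x => by
        change c * extend P χ (toHat G x) * c⁻¹ = _
        rw [extend_toHat, (hc x).eq, mul_inv_cancel_right]) w
    change c * extend P χ w * c⁻¹ = _ at this
    exact mul_inv_eq_iff_eq_mul.1 this
  exact key _ _ (fun y => (key _ _ (fun x => (h x y).symm) u).symm) v

/-- Commuting ranges make the pointwise product of the two extensions a continuous homomorphism; it
then suffices to compare on the dense image of `G`. -/
theorem extend_mul {φ ψ χ : G →* P} (h : ∀ x y, Commute (φ x) (ψ y))
    (hχ : ∀ x, χ x = φ x * ψ x) (u : Hat G) :
    extend P χ u = extend P φ u * extend P ψ u := by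
  let θ : Hat G →ₜ* P :=
    { toFun := fun u => extend P φ u * extend P ψ u
      map_one' := by simp
      map_mul' := fun u v => by
        rw [map_mul, map_mul]
        exact (commute_extend h v u).mul_mul_mul_comm _ _
      continuous_toFun := (extend P φ).continuous_toFun.mul (extend P ψ).continuous_toFun }
  refine hat_hom_ext (ψ := θ) (fun x => ?_) u
  change _ = extend P φ _ * extend P ψ _
  simp [hχ]

theorem mul_ppow {u v : P} (h : Commute u v) (l : ZHat) :
    ppow (u * v) l = ppow u l * ppow v l :=
  extend_mul (fun x y => by simpa using (h.zpow_zpow _ _)) (fun x => by simp [h.mul_zpow]) _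

@[simp]
theorem one_ppow (l : ZHat) : ppow (1 : P) l = 1 := by
  have := mul_ppow (Commute.one_left (1 : P)) l
  rwa [one_mul, left_eq_mul] at this

theorem inv_ppow (u : P) (l : ZHat) : ppow u⁻¹ l = (ppow u l)⁻¹ := by
  rw [eq_inv_iff_mul_eq_one, ← mul_ppow (Commute.refl u).inv_left, inv_mul_cancel, one_ppow]

theorem pow_ppow (u : P) (k : ℕ) (l : ZHat) : ppow (u ^ k) l = ppow u l ^ k := by
  induction k with
  | zero => simp
  | succ k ih => rw [pow_succ, pow_succ, mul_ppow ((Commute.refl u).pow_left k), ih]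

theorem ppow_two_mul (u : P) (l : ZHat) : ppow u (2 * l) = ppow (u ^ 2) l := by
  rw [two_mul, ppow_add, pow_ppow, sq]

theorem ppow_gen (l : ZHat) :
    ppow (toHat (Multiplicative ℤ) (Multiplicative.ofAdd 1)) l = toCyclic l := by
  refine hat_hom_ext (ψ := ContinuousMonoidHom.id (Hat (Multiplicative ℤ))) (fun x => ?_) _
  rw [extend_toHat]
  change _ = toHat _ x
  rw [zpowersHom_apply, ← map_zpow, ← ofAdd_zsmul]
  simp

/-- In each finite quotient `toCyclic l` is an ordinary power of the generator, so only natural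
exponents matter. This yields `ppow_mul`, by which λ-th powers can be undone when λ is a unit. -/
theorem ppow_toCyclic (l m : ZHat) : ppow (toCyclic l) m = toCyclic (l * m) := by
  refine hat_ext fun H => ?_
  have h1 : component H (ppow (toCyclic l) m) =
      component H (toCyclic m) ^ ((l : (n : ℕ+) → ZMod n) (zIndex H)).val := by
    rw [map_ppow, component_toCyclic H l, ← map_ppow, ← ppow_gen m, ← map_pow, ← pow_ppow,
      ← map_pow, ← ofAdd_nsmul]
    simp
  rw [h1, component_toCyclic H m, ← map_pow, ← map_pow, ← ofAdd_nsmul]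
  exact (component_toCyclic_eq_iff H _ (by simp)).symm

theorem ppow_mul (u : P) (l m : ZHat) : ppow (ppow u l) m = ppow u (l * m) := by
  rw [ppow.eq_1 u l, ← map_ppow, ppow_toCyclic]
  rfl

/-! ### Evaluation of words in the closed derived subgroup -/

theorem commute_ev_ev {u v u' v' : P} (f f' : FreeTwoHat) (h1 : Commute u u') (h2 : Commute u v')
    (h3 : Commute v u') (h4 : Commute v v') : Commute (ev f u v) (ev f' u' v') :=
  commute_ev _ (commute_ev _ h1.symm h3.symm).symm (commute_ev _ h2.symm h4.symm).symm

/-- Evaluation at a commuting pair has commutative image, so its closed kernel contains the derived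
subgroup and hence its closure. -/
theorem ev_eq_one {f : FreeTwoHat} (hf : f ∈ (commutator FreeTwoHat).topologicalClosure) {u v : P}
    (h : Commute u v) : ev f u v = 1 := by
  let φ : FreeTwoHat →ₜ* P := extend P (FreeGroup.lift ![u, v])
  have hcomm : ∀ s t, Commute (φ s) (φ t) := by
    have hφ : ∀ s, φ s = ev s u v := fun s => rfl
    intro s t
    rw [hφ, hφ]
    exact commute_ev_ev _ _ (.refl _) h h.symm (.refl _)
  have hle : commutator FreeTwoHat ≤ (φ : FreeTwoHat →* P).ker := by
    rw [commutator_def, Subgroup.commutator_le]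
    intro s _ t _
    rw [MonoidHom.mem_ker, map_commutatorElement, commutatorElement_eq_one_iff_commute]
    exact hcomm s t
  have hcl : IsClosed ((φ : FreeTwoHat →* P).ker : Set FreeTwoHat) :=
    isClosed_singleton.preimage φ.continuous_toFun
  exact Subgroup.topologicalClosure_minimal _ hle hcl hf

theorem ev_mul_mul {u v c d : P} (f : FreeTwoHat) (h1 : Commute u c) (h2 : Commute u d)
    (h3 : Commute v c) (h4 : Commute v d) : ev f (u * c) (v * d) = ev f u v * ev f c d := by
  have hcomm : ∀ x y, Commute (FreeGroup.lift ![u, v] x) (FreeGroup.lift ![c, d] y) := by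
    intro x y
    rw [← extend_toHat (P := P), ← extend_toHat (P := P)]
    exact commute_ev_ev _ _ h1 h2 h3 h4
  refine extend_mul hcomm (fun x => ?_) f
  induction x using FreeGroup.induction_on with
  | C1 => simp
  | of i => fin_cases i <;> simp
  | inv_of i ih => rw [map_inv, map_inv, map_inv, ih, (hcomm _ _).mul_inv, (hcomm _ _).inv_inv.eq]
  | mul x y hx hy =>
    rw [map_mul, map_mul, map_mul, hx, hy, (hcomm y x).mul_mul_mul_comm]

theorem ev_mul_left {f : FreeTwoHat} (hf : f ∈ (commutator FreeTwoHat).topologicalClosure)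
    {u v c : P} (hu : Commute c u) (hv : Commute c v) : ev f (u * c) v = ev f u v := by
  rw [← mul_one v, ev_mul_mul f hu.symm (.one_right _) hv.symm (.one_right _),
    ev_eq_one hf (.one_right _), mul_one, mul_one]

theorem ev_mul_right {f : FreeTwoHat} (hf : f ∈ (commutator FreeTwoHat).topologicalClosure)
    {u v c : P} (hu : Commute c u) (hv : Commute c v) : ev f u (v * c) = ev f u v := by
  rw [← mul_one u, ev_mul_mul f (.one_right _) hu.symm (.one_right _) hv.symm,
    ev_eq_one hf (.one_left _), mul_one, mul_one]

end Completion

/-! ### The defining relations in arbitrary profinite groups -/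

section Relations

variable {P : ProfiniteGrp.{0}} (g : GTHat)

theorem ev_mul_ev_swap (u v : P) : ev g.f u v * ev g.f v u = 1 := by
  have h := congrArg (extend P (FreeGroup.lift ![u, v])) g.relI
  have hX : extend P (FreeGroup.lift ![u, v]) genX = u := ev_genX u v
  have hY : extend P (FreeGroup.lift ![u, v]) genY = v := ev_genY u v
  rwa [map_mul, map_one, map_ev, map_ev, hX, hY] at h

@[simp]
theorem ev_inv (u v : P) : (ev g.f u v)⁻¹ = ev g.f v u :=
  inv_eq_of_mul_eq_one_right (ev_mul_ev_swap g u v)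

/-- The profinite integer `(l - 1) / 2`. -/
def GTHat.m (g : GTHat) : ZHat := g.relII.choose

theorem GTHat.l_eq (g : GTHat) : g.l = 2 * g.m + 1 := g.relII.choose_spec.1

theorem ppow_l (u : P) : ppow u g.l = u * ppow (u ^ 2) g.m := by
  rw [g.l_eq, add_comm, ppow_add, ppow_one, ppow_two_mul]

theorem hexagon_of_mul_eq_one {p q r : P} (h : p * q * r = 1) :
    ev g.f p q * ppow p g.m * ev g.f r p * ppow r g.m * ev g.f q r * ppow q g.m = 1 := by
  have h2 := congrArg (extend P (FreeGroup.lift ![p, q]))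
    (g.relII.choose_spec.2 (genX * genY)⁻¹ (mul_inv_cancel _))
  have hX : extend P (FreeGroup.lift ![p, q]) genX = p := ev_genX p q
  have hY : extend P (FreeGroup.lift ![p, q]) genY = q := ev_genY p q
  simp only [map_mul, map_one, map_ev, map_ppow, map_inv, hX, hY] at h2
  rwa [← eq_inv_of_mul_eq_one_right h] at h2

/-- The hexagon relation up to a central factor. -/
theorem hexagon {p q r w : P} (h : p * q * r = w) (hp : Commute w p) (hq : Commute w q) :
    ev g.f p q * ppow p g.m * ev g.f r p * ppow r g.m * ev g.f q r * ppow q g.m =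
      ppow w g.m := by
  have hr : Commute w r := by
    rw [← eq_inv_mul_iff_mul_eq] at h
    rw [h]
    exact (hp.mul_right hq).inv_right.mul_right (.refl w)
  -- Absorbing w into r makes the product 1; f does not see w⁻¹, and only the power of r contributes
  -- w^(-m).
  have h1 := hexagon_of_mul_eq_one g (p := p) (q := q) (r := r * w⁻¹)
    (by rw [← mul_assoc, h, mul_inv_cancel])
  rw [ev_mul_left g.f_mem hr.inv_left hp.inv_left, ev_mul_right g.f_mem hq.inv_left hr.inv_left,
    mul_ppow hr.symm.inv_right, inv_ppow] at h1
  have h2 : Commute (ppow w g.m) (ev g.f q r * ppow q g.m) :=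
    ((commute_ev _ hq hr).mul_right (commute_ppow _ hq)) |>.symm |> commute_ppow g.m |>.symm
  have h3 := h2.inv_left.eq
  rw [← mul_inv_eq_one, ← h1]
  simp only [mul_assoc] at h3 ⊢
  rw [← h3]

/-- The images of the generators under the homomorphism from `Gamma05` determined by five elements. -/
def pureGenMap {G : Type*} [Group G] (x s n α β : G) : PureGen → G
  | .A12 => x
  | .A13 => α
  | .A14 => (s * x * α)⁻¹ * (n * β)⁻¹
  | .A23 => s
  | .A24 => n * β * n⁻¹
  | .A34 => n

/-- The hypotheses say that xαs commutes with x, α, s and that nβs commutes with n, β, s (the full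
twists on strands 1, 2, 3 and 2, 3, 4), besides the two commutations of x, n and of α, β. The last
relator forces the value of `A14`, and the relators involving it then follow. -/
theorem lift_pureGenMap {G : Type*} [Group G] {x s n α β : G} (hxn : Commute x n)
    (hαβ : Commute α β) (hx : Commute x (α * s)) (hα : Commute s (x * α)) (hn : Commute n (β * s))
    (hβ : Commute s (n * β)) : ∀ r ∈ pureRels, FreeGroup.lift (pureGenMap x s n α β) r = 1 := by
  have e1 : x * α * s = s * x * α := by rw [← hα.eq, mul_assoc]
  have e2 : x * α * s = α * s * x := by rw [← hx.eq, mul_assoc]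
  have f1 : n * β * s = s * n * β := by rw [← hβ.eq, mul_assoc]
  have f2 : n * β * s = β * s * n := by rw [← hn.eq, mul_assoc]
  have hxX : Commute x (s * x * α) := by
    rw [← e1, mul_assoc]; exact (Commute.refl x).mul_right hx
  have hαX : Commute α (s * x) := by
    rw [commute_iff_eq, ← mul_assoc, ← e2, e1]
  have hβZ : Commute β (s * n) := by
    rw [commute_iff_eq, ← mul_assoc, ← f2, f1]
  have hA : (s * x * α)⁻¹ * (n * β)⁻¹ * (n * β * n⁻¹) = (s * x * α)⁻¹ * n⁻¹ := by group
  have hB : (s * x * α)⁻¹ * (n * β)⁻¹ * n = (s * x * α)⁻¹ * β⁻¹ := by group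
  intro r hr
  simp only [pureRels, Set.mem_insert_iff, Set.mem_singleton_iff] at hr
  rcases hr with rfl | rfl | rfl | rfl | rfl | rfl | rfl | rfl | rfl | rfl | rfl | rfl
  all_goals simp only [map_mul, map_inv, FreeGroup.lift_apply_of, pureGenMap]
  all_goals try rw [mul_inv_eq_one]
  · exact e2
  · rw [e1]
  · rw [mul_assoc, hA]
    exact (hxX.inv_right.mul_right hxn.inv_right).eq
  · rw [mul_assoc, hA]
    calc x * ((s * x * α)⁻¹ * n⁻¹) = n * (s * n)⁻¹ * α⁻¹ * n⁻¹ := by rw [← e1, e2]; group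
      _ = n * (β * (s * n)⁻¹ * β⁻¹) * α⁻¹ * n⁻¹ := by
        rw [hβZ.inv_right.eq, mul_inv_cancel_right]
      _ = n * β * n⁻¹ * s⁻¹ * (β⁻¹ * α⁻¹) * n⁻¹ := by group
      _ = n * β * n⁻¹ * s⁻¹ * (α⁻¹ * β⁻¹) * n⁻¹ := by rw [hαβ.inv_inv.eq]
      _ = _ := by rw [← e1, e2]; group
  · rw [mul_assoc, hB]
    exact (((hαX.mul_right (.refl α)).inv_right).mul_right hαβ.inv_right).eq
  · rw [mul_assoc, hB]
    calc α * ((s * x * α)⁻¹ * β⁻¹) = (β * s * x)⁻¹ := by group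
      _ = n * (β * s * x)⁻¹ * n⁻¹ := by
        rw [(hn.mul_right hxn.symm).inv_right.eq, mul_inv_cancel_right]
      _ = _ := by group
  · rw [← mul_assoc, ← mul_assoc, inv_mul_cancel_right, inv_mul_cancel_right, f1]
  · rw [← mul_assoc, ← mul_assoc, inv_mul_cancel_right, ← mul_assoc, ← mul_assoc,
      eq_mul_inv_iff_mul_eq]
    calc s * n * β * n = n * (β * s * n) := by rw [← f1]; simp only [mul_assoc]
      _ = n * (s * n * β) := by rw [← f2, f1]
      _ = n * s * n * β := by simp only [mul_assoc]
  · exact hxn.eq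
  · rw [← e1]
    exact ((hα.mul_right (.refl _)).inv_right.mul_right hβ.inv_right).symm.eq
  · simpa [mul_assoc] using hαβ.eq
  · rw [mul_assoc, mul_assoc, ← mul_assoc _ _ n, hA, e1]
    group
/-- Five elements whose cyclically non-adjacent pairs commute satisfy the pentagon relation. -/
theorem pentagon {y n u v k l : P} (hyn : Commute y n) (hkl : Commute k l)
    (hy : Commute y (u * k * v)) (hn : Commute n (u * l * v))
    (hk : Commute (u * v) (u * k * v * y)) (hl : Commute (u * v) (u * l * v * n)) :
    ev g.f y (u * v) * ev g.f n (u * k * v) * ev g.f (u * l * v) y * ev g.f (u * v) n *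
      ev g.f (u * k * v * y) (u * l * v * n) = 1 := by
  have h1 : y * (u * k * u⁻¹) * (u * v) = u * k * v * y := by rw [← hy.eq]; group
  have h2 : n * (u * l * u⁻¹) * (u * v) = u * l * v * n := by rw [← hn.eq]; group
  have cancel : ∀ {s w : P}, Commute s (w * s) → Commute s w := fun {s w} h => by
    simpa using h.mul_right (Commute.refl s).inv_right
  have hrel := lift_pureGenMap (x := y) (s := u * v) (n := n) (α := u * k * u⁻¹)
    (β := u * l * u⁻¹) hyn (hkl.conj u)
    (by convert hy using 1; group)
    (cancel (by rwa [← h1] at hk))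
    (by convert hn using 1; group)
    (cancel (by rwa [← h2] at hl))
  let φ : Hat Gamma05 →ₜ* P := extend P (PresentedGroup.toGroup hrel)
  have hpg : ∀ s, φ (pg s) = pureGenMap y (u * v) n (u * k * u⁻¹) (u * l * u⁻¹) s := fun s => by
    rw [pg, extend_toHat, PresentedGroup.toGroup.of]
  have h45 : φ x45 = u * k * v * y := by
    rw [x45, map_mul, map_mul, hpg, hpg, hpg]
    exact h1
  have h51 : φ x51 = u * l * v * n := by
    rw [x51, map_mul, map_mul, hpg, hpg, hpg, pureGenMap, pureGenMap, pureGenMap,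
      mul_assoc, inv_mul_cancel_right, ← h2]
    rw [← h2] at hl
    rw [← mul_assoc, mul_assoc, (cancel hl).eq]
  have h := congrArg φ g.relIII
  have h12 : φ x12 = y := hpg _
  have h23 : φ x23 = u * v := hpg _
  have h34 : φ x34 = n := hpg _
  simp only [map_mul, map_ev, map_one, h12, h23, h34, h45, h51] at h
  -- The factor y of the image of `x45`, and n of that of `x51`, drop out of the second and third
  -- terms, but not of the last.
  rwa [ev_mul_right g.f_mem hyn hy, ev_mul_left g.f_mem hn hyn.symm] at h

end Relations

/-! ### Drinfeld's formula for the image of a braid generator -/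

section Drinfeld

variable {P : ProfiniteGrp.{0}} (g : GTHat)

/-- The element `f(b², z) b^l f(z, b²)`. -/
def dr (z b : P) : P := ev g.f (b ^ 2) z * ppow b g.l * ev g.f z (b ^ 2)

theorem commute_mul_of_commute {G : Type*} [Group G] {z b : G} (hz : Commute z (b * z * b)) :
    Commute b (b * z * b * z) := by
  have := hz.eq
  rw [commute_iff_eq]
  simp only [mul_assoc] at this ⊢
  rw [this]

theorem mul_mul_eq_of_commute {G : Type*} [Group G] {b z w f Q W Z : G} (hw : w = b * z * b * z)
    (hzZ : Commute z Z) (h2 : f * (z * b) * f = z * b) (h3 : b * Q⁻¹ = Z⁻¹ * b)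
    (hWZ : Commute W Z) (hWb : Commute W b) (hWz : Commute W z) (hWQ : Commute W Q)
    (hWf : Commute W f) (hwW : Commute w W) (hwZ : Commute w Z) :
    b * W * Q⁻¹ * f * Z⁻¹ * (z * Z ^ 2) * (b * W * Q⁻¹ * f * Z⁻¹) =
      w * W ^ 2 * (z * Z ^ 2)⁻¹ := by
  have e1 : b * W * Q⁻¹ * f * Z⁻¹ = W * (b * Q⁻¹ * f * Z⁻¹) := by
    rw [← hWb.eq]; simp only [mul_assoc]
  have e2 : Z⁻¹ * (z * Z ^ 2) = z * Z := by
    rw [sq, ← mul_assoc, ← hzZ.inv_right.eq, mul_assoc, inv_mul_cancel_left]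
  have e3 : Commute W (b * Q⁻¹ * f * Z⁻¹) := ((hWb.mul_right hWQ.inv_right).mul_right hWf).mul_right hWZ.inv_right
  have e4 : Commute W (z * Z ^ 2) := hWz.mul_right (hWZ.pow_right 2)
  have e5 : b * Q⁻¹ * f * Z⁻¹ * (z * Z ^ 2) * (b * Q⁻¹ * f * Z⁻¹) = w * (z * Z ^ 2)⁻¹ := by
    calc _ = b * Q⁻¹ * f * (Z⁻¹ * (z * Z ^ 2)) * (b * Q⁻¹) * f * Z⁻¹ := by simp only [mul_assoc]
      _ = (b * Q⁻¹) * (f * (z * b) * f) * Z⁻¹ := by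
        rw [e2, h3]; simp only [mul_assoc, mul_inv_cancel_left]
      _ = Z⁻¹ * w * z⁻¹ * Z⁻¹ := by
        rw [h2, h3, hw]; simp only [mul_assoc, mul_inv_cancel, mul_one]
      _ = w * (z * Z ^ 2)⁻¹ := by
        rw [← hwZ.inv_right.eq, sq, ← mul_assoc z, hzZ.eq]
        simp only [mul_assoc, mul_inv_rev]
  calc _ = W * ((b * Q⁻¹ * f * Z⁻¹ * (z * Z ^ 2)) * W) * (b * Q⁻¹ * f * Z⁻¹) := by
        rw [e1]; simp only [mul_assoc]
    _ = W * W * (b * Q⁻¹ * f * Z⁻¹ * (z * Z ^ 2) * (b * Q⁻¹ * f * Z⁻¹)) := by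
        rw [← (e3.mul_right e4).eq]; simp only [mul_assoc]
    _ = _ := by rw [e5, ← mul_assoc, ← sq, (hwW.pow_right 2).eq]

/-- The hexagon for b², q = b⁻¹zb, z, whose product w = bzbz is central in ⟨b, z⟩, rewrites D(z,b)
with f(z,q) as its only f-term. Conjugation by zb exchanges z and q, so relation (I) makes the two
copies of f(z,q) cancel. This gives F(y_i) = y_i^λ. -/
theorem dr_mul_ppow_mul_dr {z b : P} (hz : Commute z (b * z * b)) :
    dr g z b * ppow z g.l * dr g z b = ppow (b * z * b) g.l := by
  obtain ⟨q, hq⟩ : ∃ q, q = b⁻¹ * z * b := ⟨_, rfl⟩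
  obtain ⟨w, hw⟩ : ∃ w, w = b * z * b * z := ⟨_, rfl⟩
  have hwb : Commute w b := by rw [hw]; exact (commute_mul_of_commute hz).symm
  have hwz : Commute w z := by rw [hw]; exact (hz.mul_right (.refl z)).symm
  have hwq : Commute w q := by rw [hq]; exact (hwb.inv_right.mul_right hwz).mul_right hwb
  have hbq : SemiconjBy b q z := by rw [SemiconjBy, hq]; group
  have hex := hexagon g (p := b ^ 2) (q := q) (r := z) (w := w) (by rw [hq, hw]; group)
    (hwb.pow_right 2) hwq
  have h1 : dr g z b = b * ppow w g.m * (ppow q g.m)⁻¹ * ev g.f z q * (ppow z g.m)⁻¹ := by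
    have hA : ev g.f (b ^ 2) q * ppow (b ^ 2) g.m * ev g.f z (b ^ 2) =
        ppow w g.m * (ppow q g.m)⁻¹ * ev g.f z q * (ppow z g.m)⁻¹ := by
      rw [← hex, ← ev_inv g q z]
      group
    calc dr g z b = (ev g.f (b ^ 2) z * b) * (ppow (b ^ 2) g.m * ev g.f z (b ^ 2)) := by
          rw [dr, ppow_l]; simp only [mul_assoc]
      _ = b * (ev g.f (b ^ 2) q * ppow (b ^ 2) g.m * ev g.f z (b ^ 2)) := by
          rw [← (semiconjBy_ev g.f ((Commute.refl b).pow_right 2) hbq).eq]; simp only [mul_assoc]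
      _ = _ := by rw [hA]; simp only [mul_assoc]
  have hzq : SemiconjBy (z * b) z q := by
    have := hz.eq
    rw [SemiconjBy, hq, ← mul_left_cancel_iff (a := b)]
    simp only [mul_assoc, mul_inv_cancel_left] at this ⊢
    rw [this]
  have hqz : SemiconjBy (z * b) q z := (Commute.refl z).semiconjBy.mul_left hbq
  have h2 : ev g.f z q * (z * b) * ev g.f z q = z * b := by
    rw [mul_assoc, (semiconjBy_ev g.f hzq hqz).eq, ← mul_assoc, ev_mul_ev_swap, one_mul]
  have h3 : b * (ppow q g.m)⁻¹ = (ppow z g.m)⁻¹ * b := (semiconjBy_ppow g.m hbq).inv_right.eq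
  have h4 : b * z * b = w * z⁻¹ := by rw [hw, mul_inv_cancel_right]
  have hWz : Commute (ppow w g.m) z := (commute_ppow _ hwz.symm).symm
  rw [h4, mul_ppow hwz.inv_right, inv_ppow, h1, ppow_l, ppow_l, pow_ppow, pow_ppow]
  exact mul_mul_eq_of_commute hw (commute_self_ppow z g.m) h2 h3 (ppow_comm hwz _ _)
    (commute_ppow _ hwb.symm).symm hWz (ppow_comm hwq _ _)
    (commute_ev _ hWz (commute_ppow _ hwq.symm).symm) (commute_self_ppow w g.m)
    (commute_ppow _ hwz)

end Drinfeld

/-! ### The braid relation -/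

section BraidRelation

variable {P : ProfiniteGrp.{0}} (g : GTHat)

theorem commute_mul_sq_mul {G : Type*} [Group G] {b c : G} (h : b * c * b = c * b * c) :
    Commute c (b * c ^ 2 * b) := by
  calc c * (b * c ^ 2 * b) = (c * b * c) * (c * b) := by simp only [sq, mul_assoc]
    _ = b * c * (b * c * b) := by rw [← h]; simp only [mul_assoc]
    _ = b * c ^ 2 * b * c := by rw [h]; simp only [sq, mul_assoc]

theorem semiconjBy_of_braid {G : Type*} [Group G] {b c : G} (h : b * c * b = c * b * c) :
    SemiconjBy (c * b) c b := by
  rw [SemiconjBy, ← h, mul_assoc]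

/-- The case u = v = b, k = y, l = n of `pentagon`. -/
theorem pentagon_swap {y b n : P} (hyn : Commute y n) (hy : Commute y (b * y * b))
    (hn : Commute n (b * n * b)) :
    ev g.f y (b ^ 2) * ev g.f n (b * y * b) * ev g.f (b * n * b) y * ev g.f (b ^ 2) n *
      ev g.f (b * y * b * y) (b * n * b * n) = 1 := by
  have h1 := commute_mul_of_commute hy
  have h2 := commute_mul_of_commute hn
  have := pentagon g hyn hyn hy hn (h1.mul_left h1) (h2.mul_left h2)
  rwa [← sq] at this

/-- The three-strand case: the hexagon for c², b², cb²c⁻¹, whose product is the full twist on three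
strands. -/
theorem dr_sq_mul_ppow {b c : P} (h : b * c * b = c * b * c) :
    dr g (b ^ 2) c * ppow b g.l =
      c * b * ppow (b * c ^ 2 * b) g.m * ev g.f (b ^ 2) (c ^ 2) := by
  obtain ⟨r, hr⟩ : ∃ r, r = c * b ^ 2 * c⁻¹ := ⟨_, rfl⟩
  obtain ⟨w, hw⟩ : ∃ w, w = c ^ 2 * b ^ 2 * r := ⟨_, rfl⟩
  have hcN := commute_mul_sq_mul h
  have hw' : w = b * c ^ 2 * b * c ^ 2 := by
    rw [← (hcN.pow_left 2).eq, hw, hr]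
    calc c ^ 2 * b ^ 2 * (c * b ^ 2 * c⁻¹) = c ^ 2 * b * (b * c * b) * b * c⁻¹ := by
          simp only [sq, mul_assoc]
      _ = c ^ 2 * b * (c * b * c) * b * c⁻¹ := by rw [h]
      _ = c ^ 2 * b * c * (b * c * b) * c⁻¹ := by simp only [mul_assoc]
      _ = c ^ 2 * b * c * (c * b * c) * c⁻¹ := by rw [h]
      _ = c ^ 2 * (b * c ^ 2 * b) := by simp only [sq, mul_assoc, mul_inv_cancel, mul_one]
  have hwc : Commute w c := by
    rw [hw']; exact (hcN.mul_right ((Commute.refl c).pow_right 2)).symm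
  have hwb : Commute w b := by
    rw [hw']; exact (commute_mul_of_commute (hcN.pow_left 2)).symm
  have hex := hexagon g (p := c ^ 2) (q := b ^ 2) (r := r) hw.symm (hwc.pow_right 2)
    (hwb.pow_right 2)
  have hcb : SemiconjBy (c * b) (c ^ 2) (b ^ 2) := (semiconjBy_of_braid h).pow_right 2
  have hcr : SemiconjBy c (b ^ 2) r := by rw [SemiconjBy, hr, inv_mul_cancel_right]
  have hcbr : SemiconjBy (c * b) (b ^ 2) r :=
    hcr.mul_left ((Commute.refl b).pow_right 2).semiconjBy
  have hN : ppow (b * c ^ 2 * b) g.m = ppow w g.m * (ppow (c ^ 2) g.m)⁻¹ := by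
    rw [← inv_ppow, ← mul_ppow (hwc.pow_right 2).inv_right, hw', mul_inv_cancel_right]
  have e1 := (semiconjBy_ev g.f hcr ((Commute.refl c).pow_right 2).semiconjBy).eq
  have e2 := (semiconjBy_ev g.f hcbr hcb).eq
  have e3 := (semiconjBy_ppow g.m hcbr).eq
  have e4 := (semiconjBy_ppow g.m hcb).inv_right.eq
  have e5 : Commute (ppow w g.m) (c * b) :=
    ((commute_ppow _ hwc.symm).mul_left (commute_ppow _ hwb.symm)).symm
  have e6 : c * ppow (c ^ 2) g.m = ppow (c ^ 2) g.m * c :=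
    (commute_ppow _ ((Commute.refl c).pow_right 2)).eq
  rw [dr, ppow_l, ppow_l, hN, e6]
  calc ev g.f (c ^ 2) (b ^ 2) * (ppow (c ^ 2) g.m * c) * ev g.f (b ^ 2) (c ^ 2) *
        (b * ppow (b ^ 2) g.m)
      = ev g.f (c ^ 2) (b ^ 2) * ppow (c ^ 2) g.m * (c * ev g.f (b ^ 2) (c ^ 2)) *
        (b * ppow (b ^ 2) g.m) := by simp only [mul_assoc]
    _ = ev g.f (c ^ 2) (b ^ 2) * ppow (c ^ 2) g.m * ev g.f r (c ^ 2) *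
        (c * b * ppow (b ^ 2) g.m) := by rw [e1]; simp only [mul_assoc]
    _ = (ev g.f (c ^ 2) (b ^ 2) * ppow (c ^ 2) g.m * ev g.f r (c ^ 2) * ppow r g.m *
          ev g.f (b ^ 2) r * ppow (b ^ 2) g.m) * ((ppow (b ^ 2) g.m)⁻¹ *
            ((ev g.f (b ^ 2) r)⁻¹ * (c * b))) := by
        rw [e3]; simp only [mul_assoc, mul_inv_cancel_left]
    _ = ppow w g.m * ((ppow (b ^ 2) g.m)⁻¹ * (c * b) * ev g.f (b ^ 2) (c ^ 2)) := by
        rw [hex, ev_inv, ← e2]; simp only [mul_assoc]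
    _ = _ := by rw [← e4, ← mul_assoc, ← mul_assoc, e5.eq, mul_assoc (c * b)]

/-- The data of a band `z` next to two strands which are interchanged with their neighbours by
`b` and `c`. -/
structure Triple {G : Type*} [Group G] (z b c : G) : Prop where
  zb : Commute z (b * z * b)
  zc : Commute z c
  bc : b * c * b = c * b * c

theorem semiconjBy_mul_conj {G : Type*} [Group G] {A E A' u : G} (hA : A⁻¹ = A')
    (hE : Commute E u) : SemiconjBy (E * A) (A' * u * A) u := by
  rw [SemiconjBy, ← hA, mul_assoc, mul_assoc A⁻¹, mul_inv_cancel_left, ← mul_assoc, hE.eq,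
    mul_assoc]

theorem semiconjBy_of_pentagon {G : Type*} [Group G] {A B C D E B' C' D' u : G} (hB : B⁻¹ = B')
    (hC : C⁻¹ = C') (hD : D⁻¹ = D') (h : A * B * C * D * E = 1) (hC' : Commute C' u) :
    SemiconjBy (E * A) (B * u * B') (D' * u * D) := by
  have hE : E * A = D' * C' * B' := by
    rw [← hB, ← hC, ← hD, eq_inv_of_mul_eq_one_right h]; group
  rw [SemiconjBy, hE, ← hB]
  calc D' * C' * B⁻¹ * (B * u * B⁻¹) = D' * (C' * u) * B⁻¹ := by group
    _ = D' * u * D * (D⁻¹ * C' * B⁻¹) := by rw [hC'.eq]; group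
    _ = _ := by rw [hD]

theorem mul_eq_of_pentagon {G : Type*} [Group G] {A B C D E B' C' : G} (hB : B⁻¹ = B')
    (hC : C⁻¹ = C') (h : A * B * C * D * E = 1) : D * (E * A) = C' * B' := by
  rw [← hB, ← hC, eq_inv_of_mul_eq_one_right h]; group

/-- Read the pentagon for z, b, c² as ABCDE = 1 and take e = EA. Since E commutes with b, e strips A
from D(z,b); since e is also D⁻¹C⁻¹B⁻¹ and C commutes with c, it replaces B by D⁻¹ around c^λ. So
the band z is removed from both elements at once. -/
theorem Triple.dr_semiconj {z b c : P} (h : Triple z b c) :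
    ∃ e : P, SemiconjBy e (dr g z b) (ppow b g.l) ∧
      SemiconjBy e (dr g (b * z * b) c) (dr g (b ^ 2) c) ∧
      e = ev g.f (b * z * b * z) (b * c ^ 2 * b * c ^ 2) * ev g.f z (b ^ 2) ∧
      ev g.f (b ^ 2) (c ^ 2) * e = ev g.f z (b * c ^ 2 * b) * ev g.f (b * z * b) (c ^ 2) := by
  have hcN := commute_mul_sq_mul h.bc
  have hp := pentagon_swap g (h.zc.pow_right 2) h.zb (hcN.pow_left 2)
  have hb : Commute b (ev g.f (b * z * b * z) (b * c ^ 2 * b * c ^ 2)) :=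
    commute_ev _ (commute_mul_of_commute h.zb) (commute_mul_of_commute (hcN.pow_left 2))
  have hc : Commute c (ev g.f z (b * c ^ 2 * b)) := commute_ev _ h.zc.symm hcN
  exact ⟨_, semiconjBy_mul_conj (ev_inv g _ _) (commute_ppow g.l hb.symm),
    semiconjBy_of_pentagon (ev_inv g _ _) (ev_inv g _ _) (ev_inv g _ _) hp
      (commute_ppow g.l hc.symm), rfl,
    mul_eq_of_pentagon (ev_inv g _ _) (ev_inv g _ _) hp⟩

theorem Triple.dr_braid {z b c : P} (h : Triple z b c) :
    dr g z b * dr g (b * z * b) c * dr g z b =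
      dr g (b * z * b) c * dr g z b * dr g (b * z * b) c := by
  obtain ⟨e, h1, h2, -, -⟩ := h.dr_semiconj g
  have h3 := ((h1.mul_right h2).mul_right h1).eq
  have h4 := ((h2.mul_right h1).mul_right h2).eq
  -- The braid relation with the band removed: cb carries c^λ to b^λ, and the two mutually inverse
  -- values of f cancel.
  have h5 : ppow b g.l * dr g (b ^ 2) c * ppow b g.l =
      dr g (b ^ 2) c * ppow b g.l * dr g (b ^ 2) c := by
    have hc : Commute c (ppow (b * c ^ 2 * b) g.m) := commute_ppow _ (commute_mul_sq_mul h.bc)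
    have hcb := (semiconjBy_ppow g.l (semiconjBy_of_braid h.bc)).eq
    have hcN : Commute (ppow (b * c ^ 2 * b) g.m) (ppow c g.l) := commute_ppow _ hc.symm
    rw [mul_assoc, dr_sq_mul_ppow g h.bc, dr]
    calc ppow b g.l * (c * b * ppow (b * c ^ 2 * b) g.m * ev g.f (b ^ 2) (c ^ 2))
        = c * b * (ppow c g.l * ppow (b * c ^ 2 * b) g.m) * ev g.f (b ^ 2) (c ^ 2) := by
          rw [← mul_assoc, ← mul_assoc, ← hcb]; simp only [mul_assoc]
      _ = c * b * ppow (b * c ^ 2 * b) g.m * (ev g.f (b ^ 2) (c ^ 2) * ev g.f (c ^ 2) (b ^ 2)) *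
          ppow c g.l * ev g.f (b ^ 2) (c ^ 2) := by
          rw [← hcN.eq, ev_mul_ev_swap, mul_one]; simp only [mul_assoc]
      _ = _ := by simp only [mul_assoc]
  rw [← mul_right_inj e, h3, h4, h5]

end BraidRelation

/-! ### Relations in the profinite braid group -/

section BraidGroup

variable {n : ℕ}

theorem a_of_mem {i : ℕ} (h : i ∈ Set.Ico 1 n) :
    a n i = toHat (Braid n) (PresentedGroup.of ⟨i, h⟩) := dif_pos h

theorem a_comm {i j : ℕ} (hij : i + 1 < j) : Commute (a n i) (a n j) := by
  by_cases hi : i ∈ Set.Ico 1 n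
  · by_cases hj : j ∈ Set.Ico 1 n
    · rw [a_of_mem hi, a_of_mem hj]
      have : PresentedGroup.mk (braidRels n) (FreeGroup.of ⟨i, hi⟩ * FreeGroup.of ⟨j, hj⟩ *
          (FreeGroup.of ⟨j, hj⟩ * FreeGroup.of ⟨i, hi⟩)⁻¹) = 1 :=
        PresentedGroup.one_of_mem (Or.inl ⟨_, _, hij, rfl⟩)
      rw [map_mul, map_inv, mul_inv_eq_one, map_mul, map_mul] at this
      rw [commute_iff_eq, ← map_mul, ← map_mul]
      exact congrArg _ this
    · rw [a.eq_1 n j, dif_neg hj]; exact .one_right _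
  · rw [a.eq_1 n i, dif_neg hi]; exact .one_left _

theorem a_braid {i : ℕ} (h1 : 1 ≤ i) (hi : i + 1 < n) :
    a n i * a n (i + 1) * a n i = a n (i + 1) * a n i * a n (i + 1) := by
  have hi0 : i ∈ Set.Ico 1 n := ⟨h1, by omega⟩
  have hi1 : i + 1 ∈ Set.Ico 1 n := ⟨by omega, hi⟩
  rw [a_of_mem hi0, a_of_mem hi1]
  have : PresentedGroup.mk (braidRels n) (FreeGroup.of ⟨i, hi0⟩ * FreeGroup.of ⟨i + 1, hi1⟩ *
      FreeGroup.of ⟨i, hi0⟩ * (FreeGroup.of ⟨i + 1, hi1⟩ * FreeGroup.of ⟨i, hi0⟩ *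
        FreeGroup.of ⟨i + 1, hi1⟩)⁻¹) = 1 :=
    PresentedGroup.one_of_mem (Or.inr ⟨_, _, rfl, rfl⟩)
  rw [map_mul, map_inv, mul_inv_eq_one] at this
  simp only [map_mul] at this
  simp only [← map_mul]
  exact congrArg _ this

theorem y_succ {i : ℕ} (hi : 1 ≤ i) : y n (i + 1) = a n i * y n i * a n i := by
  obtain ⟨k, rfl⟩ := Nat.exists_eq_add_of_le' hi
  rfl

theorem commute_y_of_forall {u : BraidHat n} {i : ℕ} (h : ∀ j, 1 ≤ j → j < i → Commute u (a n j)) :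
    Commute u (y n i) := by
  induction i with
  | zero => exact .one_right _
  | succ i ih =>
    rcases Nat.eq_zero_or_pos i with rfl | hi
    · exact .one_right _
    · rw [y_succ hi]
      have h1 := h i hi (by omega)
      exact (h1.mul_right (ih fun j h1 h2 => h j h1 (by omega))).mul_right h1

theorem y_comm_a {i j : ℕ} (hij : i < j) : Commute (y n i) (a n j) :=
  (commute_y_of_forall fun _ _ h => (a_comm (by omega)).symm).symm

theorem Triple.commute_mul {G : Type*} [Group G] {z b c : G} (h : Triple z b c) :
    Commute b (c * (b * z * b) * c) := by
  have hzc := h.zc.eq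
  calc b * (c * (b * z * b) * c) = (b * c * b) * z * b * c := by simp only [mul_assoc]
    _ = c * b * (c * z) * b * c := by rw [h.bc]; simp only [mul_assoc]
    _ = c * b * z * (c * b * c) := by rw [← hzc]; simp only [mul_assoc]
    _ = c * (b * z * b) * c * b := by rw [← h.bc]; simp only [mul_assoc]

theorem Triple.commute_next {G : Type*} [Group G] {z b c : G} (h : Triple z b c) :
    Commute (b * z * b) (c * (b * z * b) * c) :=
  have hz : Commute z (c * (b * z * b) * c) := (h.zc.mul_right h.zb).mul_right h.zc
  (h.commute_mul.mul_left hz).mul_left h.commute_mul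

theorem triple {i : ℕ} (h1 : 1 ≤ i) (hi : i + 1 < n) :
    Triple (y n i) (a n i) (a n (i + 1)) := by
  refine ⟨?_, y_comm_a (by omega), a_braid h1 hi⟩
  induction i, h1 using Nat.le_induction with
  | base => exact .one_left _
  | succ i h1 ih =>
    rw [y_succ h1]
    exact Triple.commute_next ⟨ih (by omega), y_comm_a (by omega), a_braid h1 (by omega)⟩

theorem y_comm_mul {i : ℕ} (h1 : 1 ≤ i) (hi : i < n) :
    Commute (y n i) (a n i * y n i * a n i) := by
  obtain ⟨i, rfl⟩ := Nat.exists_eq_add_of_le' h1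
  rcases Nat.eq_zero_or_pos i with rfl | h
  · exact .one_left _
  · rw [y_succ h]
    exact (triple h hi).commute_next

theorem a_comm_y {j i : ℕ} (hj : 1 ≤ j) (hij : j + 2 ≤ i) (hi : i ≤ n) :
    Commute (a n j) (y n i) := by
  obtain ⟨i, rfl⟩ := Nat.exists_eq_add_of_le' (show 2 ≤ i by omega)
  induction i with
  | zero => omega
  | succ i ih =>
    rw [y_succ (by omega)]
    rcases Nat.lt_or_ge j (i + 1) with h | h
    · have h1 : Commute (a n j) (a n (i + 1 + 1)) := a_comm (by omega)
      exact (h1.mul_right (ih (by omega) (by omega))).mul_right h1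
    · obtain rfl : j = i + 1 := by omega
      rw [y_succ (by omega)]
      exact (triple (by omega) (by omega)).commute_mul

theorem y_comm_y {i j : ℕ} (hij : i < j) (hj : j ≤ n) : Commute (y n i) (y n j) :=
  (commute_y_of_forall fun k h1 h2 => (a_comm_y h1 (by omega) hj).symm).symm

end BraidGroup

/-! ### Surjective endomorphisms of profinite completions of finitely generated groups -/

section Hopf

variable {G : Type} [Group G]

theorem finite_monoidHom [hG : Group.FG G] (Q : Type*) [Group Q] [Finite Q] :
    Finite (G →* Q) := by
  obtain ⟨S, hS⟩ := Group.fg_def.1 hG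
  refine Finite.of_injective (fun (χ : G →* Q) (s : S) => χ s) fun χ ψ h => ?_
  exact MonoidHom.eq_of_eqOn_dense hS fun s hs => congrFun h ⟨s, hs⟩

/-- For a finite quotient Q there are finitely many continuous homomorphisms to Q. Precomposition
with φ is injective on them, hence surjective, so every projection to a finite quotient factors
through φ and kills its kernel. -/
theorem injective_of_surjective [Group.FG G] (φ : Hat G →ₜ* Hat G)
    (hφ : Function.Surjective φ) : Function.Injective φ := by
  rw [injective_iff_map_eq_one]
  intro u hu
  refine hat_ext fun H => ?_
  let Q := (ProfiniteCompletion.diagram (GrpCat.of G)).obj H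
  have : Finite Q := inferInstanceAs (Finite (G ⧸ H.toSubgroup))
  have hfin : Finite (Hat G →ₜ* Q) := by
    have := finite_monoidHom (G := G) Q
    refine Finite.of_injective (fun χ : Hat G →ₜ* Q => (χ : Hat G →* Q).comp (toHat G))
      fun χ ψ h => ?_
    ext x
    exact hat_hom_ext (fun y => DFunLike.congr_fun h y) x
  have hinj : Function.Injective (fun χ : Hat G →ₜ* Q => χ.comp φ) := fun χ ψ h => by
    ext x
    obtain ⟨x, rfl⟩ := hφ x
    exact DFunLike.congr_fun h x
  obtain ⟨χ, hχ⟩ := Finite.surjective_of_injective hinj (component H)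
  have h := DFunLike.congr_fun hχ u
  rw [map_one, ← h]
  change χ (φ u) = 1
  rw [hu, map_one]

end Hopf

/-! ### Existence and uniqueness of Drinfeld's action -/

section Action

variable {P : ProfiniteGrp.{0}} {n : ℕ} (g : GTHat)

theorem map_eq_ev (φ : FreeTwoHat →ₜ* P) (u : FreeTwoHat) : φ u = ev u (φ genX) (φ genY) := by
  refine hat_hom_ext (ψ := extend P (FreeGroup.lift ![φ genX, φ genY])) (fun x => ?_) u
  rw [extend_toHat]
  have : (φ : FreeTwoHat →* P).comp (toHat (FreeGroup (Fin 2))) =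
      FreeGroup.lift ![φ genX, φ genY] := by
    ext i
    fin_cases i <;> simp [genX, genY]
  exact DFunLike.congr_fun this x

theorem dr_one (b : P) : dr g 1 b = ppow b g.l := by
  rw [dr, ev_eq_one g.f_mem (.one_right _), ev_eq_one g.f_mem (.one_left _), one_mul, mul_one]

theorem dr_sq (z b : P) :
    dr g z b ^ 2 = ev g.f (b ^ 2) z * ppow (b ^ 2) g.l * ev g.f z (b ^ 2) := by
  rw [pow_ppow, dr, ← ev_inv g (b ^ 2), conj_pow]

theorem isDrinfeldAction_iff (hn : 2 ≤ n) (F : BraidHat n ≃ₜ* BraidHat n) :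
    IsDrinfeldAction g n F ↔ ∀ i, 1 ≤ i → i < n → F (a n i) = dr g (y n i) (a n i) := by
  constructor
  · rintro ⟨h1, h2⟩ i hi hin
    obtain rfl | hi := hi.eq_or_lt
    · rw [h1]; exact (dr_one g _).symm
    · exact h2 i hi (by omega)
  · intro h
    refine ⟨?_, fun i hi hin => h i (by omega) (by omega)⟩
    rw [h 1 le_rfl (by omega)]
    exact dr_one g _

theorem commute_dr {u z b : P} (hz : Commute u z) (hb : Commute u b) : Commute u (dr g z b) :=
  ((commute_ev _ (hb.pow_right 2) hz).mul_right (commute_ppow _ hb)).mul_right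
    (commute_ev _ hz (hb.pow_right 2))

theorem dr_comm_dr {i j : ℕ} (h1 : 1 ≤ i) (hij : i + 1 < j) (hj : j ≤ n) :
    Commute (dr g (y n i) (a n i)) (dr g (y n j) (a n j)) :=
  commute_dr g (commute_dr g (y_comm_y (by omega) hj).symm (a_comm_y h1 hij hj).symm).symm
    (commute_dr g (y_comm_a (by omega)).symm (a_comm hij).symm).symm

/-- Drinfeld's action as an endomorphism of the profinite braid group. -/
theorem exists_endomorphism (n : ℕ) : ∃ φ : BraidHat n →ₜ* BraidHat n,
    ∀ i, 1 ≤ i → i < n → φ (a n i) = dr g (y n i) (a n i) := by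
  have hrel : ∀ r ∈ braidRels n,
      FreeGroup.lift (fun i : Set.Ico 1 n => dr g (y n i) (a n i)) r = 1 := by
    rintro r (⟨⟨i, hi⟩, ⟨j, hj⟩, hij, rfl⟩ | ⟨⟨i, hi⟩, ⟨j, hj⟩, hij, rfl⟩)
    · simp only [map_mul, map_inv, FreeGroup.lift_apply_of]
      rw [mul_inv_eq_one]
      exact (dr_comm_dr g hi.1 hij hj.2.le).eq
    · obtain rfl : i + 1 = j := hij
      simp only [map_mul, map_inv, FreeGroup.lift_apply_of]
      rw [mul_inv_eq_one, y_succ hi.1]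
      exact (triple hi.1 hj.2).dr_braid g
  refine ⟨extend _ (PresentedGroup.toGroup hrel), fun i h1 hi => ?_⟩
  rw [a_of_mem ⟨h1, hi⟩, extend_toHat, PresentedGroup.toGroup.of, ← a_of_mem ⟨h1, hi⟩]

theorem map_y {φ : BraidHat n →ₜ* BraidHat n}
    (hφ : ∀ i, 1 ≤ i → i < n → φ (a n i) = dr g (y n i) (a n i)) {i : ℕ} (h1 : 1 ≤ i)
    (hi : i ≤ n) : φ (y n i) = ppow (y n i) g.l := by
  induction i, h1 using Nat.le_induction with
  | base => exact (map_one φ).trans (one_ppow _).symm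
  | succ i h1 ih =>
    rw [y_succ h1, map_mul, map_mul, hφ i h1 (by omega), ih (by omega),
      dr_mul_ppow_mul_dr g (y_comm_mul h1 (by omega))]

theorem bijective_endomorphism {φ : BraidHat n →ₜ* BraidHat n}
    (hφ : ∀ i, 1 ≤ i → i < n → φ (a n i) = dr g (y n i) (a n i)) : Function.Bijective φ := by
  have hsurj : Function.Surjective φ := by
    have ha : ∀ i : Set.Ico 1 n, a n i ∈ Set.range φ := by
      rintro ⟨i, h1, hi⟩
      obtain ⟨θ, hX, hY⟩ := g.exists_aut
      let ψ : FreeTwoHat →ₜ* BraidHat n := extend _ (FreeGroup.lift ![y n i, a n i ^ 2])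
      have hψX : ψ genX = y n i := ev_genX _ _
      have hψY : ψ genY = a n i ^ 2 := ev_genY _ _
      -- On the copy of the free group mapped in by x ↦ y_i, y ↦ a_i², φ acts as the automorphism θ
      -- attached to (λ, f); hence the range of ψ lies in that of φ.
      have hψ : ∀ u, φ (ψ u) = ψ (θ u) := by
        intro u
        have e1 := map_eq_ev (φ.comp ψ) u
        have e2 := map_eq_ev (ψ.comp (θ : FreeTwoHat →ₜ* FreeTwoHat)) u
        have eX : φ (ψ genX) = ψ (θ genX) := by
          rw [hψX, hX, map_ppow, hψX, map_y g hφ h1 hi.le]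
        have eY : φ (ψ genY) = ψ (θ genY) := by
          have hf : ψ g.f = ev g.f (y n i) (a n i ^ 2) := rfl
          rw [hψY, hY, map_mul, map_mul, map_inv, map_ppow, hψY, map_pow, hφ i h1 hi, dr_sq, hf,
            ev_inv]
        change φ (ψ u) = ev u (φ (ψ genX)) (φ (ψ genY)) at e1
        change ψ (θ u) = ev u (ψ (θ genX)) (ψ (θ genY)) at e2
        rw [e1, e2, eX, eY]
      have hmem : ∀ u, ψ u ∈ (φ : BraidHat n →* BraidHat n).range := fun u =>
        ⟨ψ (θ.symm u), by
          change φ _ = _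
          rw [hψ, ContinuousMulEquiv.apply_symm_apply]⟩
      have hf : ev g.f (y n i) (a n i ^ 2) ∈ (φ : BraidHat n →* BraidHat n).range := hmem g.f
      have hdr : dr g (y n i) (a n i) ∈ (φ : BraidHat n →* BraidHat n).range :=
        ⟨_, hφ i h1 hi⟩
      -- Both outer factors of D(y_i,a_i) are now in the range, so they can be cancelled; the
      -- inverse of λ then recovers a_i.
      have hl : ppow (a n i) g.l ∈ (φ : BraidHat n →* BraidHat n).range := by
        rwa [dr, ← ev_inv g (y n i), Subgroup.mul_mem_cancel_right _ hf,
          Subgroup.mul_mem_cancel_left _ (inv_mem hf)] at hdr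
      obtain ⟨u, hu⟩ := hl
      change φ u = _ at hu
      obtain ⟨m, hm⟩ := g.isUnit_l.exists_right_inv
      exact ⟨ppow u m, by rw [map_ppow, hu, ppow_mul, hm, ppow_one]⟩
    have hrange : Set.range (toHat (Braid n)) ⊆ (φ : BraidHat n →* BraidHat n).range := by
      rw [← MonoidHom.coe_range, SetLike.coe_subset_coe, MonoidHom.range_eq_map,
        ← PresentedGroup.closure_range_of, MonoidHom.map_closure, Subgroup.closure_le]
      rintro _ ⟨_, ⟨i, rfl⟩, rfl⟩
      rw [← a_of_mem i.2]
      exact ha i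
    have hclosed : IsClosed (Set.range φ) := (isCompact_range φ.continuous_toFun).isClosed
    rw [← Set.range_eq_univ, ← hclosed.closure_eq]
    exact (denseRange_toHat.mono hrange).closure_eq
  have : Group.FG (Braid n) := inferInstanceAs (Group.FG (FreeGroup (Set.Ico 1 n) ⧸ _))
  exact ⟨injective_of_surjective φ hsurj, hsurj⟩

theorem existsUnique_isDrinfeldAction (hn : 2 ≤ n) :
    ∃! F : BraidHat n ≃ₜ* BraidHat n, IsDrinfeldAction g n F := by
  obtain ⟨φ, hφ⟩ := exists_endomorphism g n
  have hbij := bijective_endomorphism g hφ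
  let F : BraidHat n ≃ₜ* BraidHat n :=
    { MulEquiv.ofBijective (φ : BraidHat n →* BraidHat n) hbij with
      continuous_toFun := φ.continuous_toFun
      continuous_invFun := (Continuous.continuous_symm_of_equiv_compact_to_t2
        (f := Equiv.ofBijective φ hbij) φ.continuous_toFun) }
  refine ⟨F, (isDrinfeldAction_iff g hn F).2 hφ, fun F' hF' => ?_⟩
  replace hF' := (isDrinfeldAction_iff g hn F').1 hF'
  have h : ((F' : BraidHat n →* BraidHat n).comp (toHat (Braid n))) =
      (φ : BraidHat n →* BraidHat n).comp (toHat (Braid n)) := by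
    ext i
    change F' (toHat _ _) = φ (toHat _ _)
    rw [← a_of_mem i.2, hF' i i.2.1 i.2.2, hφ i i.2.1 i.2.2]
  ext u
  exact hat_hom_ext (φ := (F' : BraidHat n →ₜ* BraidHat n)) (ψ := φ)
    (fun x => DFunLike.congr_fun h x) u

end Action

/-! ### Crossings of bands of two strands -/

section Bands

theorem garside_sq {G : Type*} [Group G] {b c : G} (h : b * c * b = c * b * c) :
    b * c ^ 2 * b * c ^ 2 = c * b ^ 2 * c * b ^ 2 := by
  calc b * c ^ 2 * b * c ^ 2 = b * c * (c * b * c) * c := by simp only [sq, mul_assoc]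
    _ = b * c * (b * c * b) * c := by rw [h]
    _ = (b * c * b) * (c * b * c) := by simp only [mul_assoc]
    _ = (c * b * c) * (b * c * b) := by rw [h]
    _ = c * b * (c * b * c) * b := by simp only [mul_assoc]
    _ = c * b * (b * c * b) * b := by rw [h]
    _ = c * b ^ 2 * c * b ^ 2 := by simp only [sq, mul_assoc]

/-- The relations between a band `y` and four strands, the neighbours among which are interchanged
by `a`, `b`, `c`. -/
structure Quad {G : Type*} [Group G] (y a b c : G) : Prop where
  ya : Commute y (a * y * a)
  yb : Commute y b
  yc : Commute y c
  ab : a * b * a = b * a * b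
  bc : b * c * b = c * b * c
  ac : Commute a c

namespace Quad

variable {G : Type*} [Group G] {y a b c : G} (h : Quad y a b c)
include h

theorem triple : Triple y a b := ⟨h.ya, h.yb, h.ab⟩

theorem triple_next : Triple (a * y * a) b c :=
  ⟨h.triple.commute_next, (h.ac.mul_left h.yc).mul_left h.ac, h.bc⟩

theorem triple_left : Triple (a ^ 2) b c :=
  ⟨(commute_mul_sq_mul h.ab.symm).pow_left 2, h.ac.pow_left 2, h.bc⟩

theorem triple_right : Triple (c ^ 2) b a :=
  ⟨(commute_mul_sq_mul h.bc).pow_left 2, h.ac.symm.pow_left 2, h.ab.symm⟩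

theorem semiconj_a : SemiconjBy (b * c * a * b) a c := by
  calc b * c * a * b * a = b * c * (a * b * a) := by simp only [mul_assoc]
    _ = b * c * b * (a * b) := by rw [h.ab]; simp only [mul_assoc]
    _ = c * (b * c * a * b) := by rw [h.bc]; simp only [mul_assoc]

theorem semiconj_c : SemiconjBy (b * c * a * b) c a := by
  calc b * c * a * b * c = b * (c * a) * b * c := by simp only [mul_assoc]
    _ = b * a * (c * b * c) := by rw [← h.ac.eq]; simp only [mul_assoc]
    _ = b * a * b * (c * b) := by rw [← h.bc]; simp only [mul_assoc]
    _ = a * (b * (a * c) * b) := by rw [← h.ab]; simp only [mul_assoc]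
    _ = a * (b * c * a * b) := by rw [h.ac.eq]; simp only [mul_assoc]

theorem band_eq : b * a * (c * b) = b * c * a * b := by
  rw [mul_assoc b c, ← h.ac.eq]; simp only [mul_assoc]

theorem commute_sq_a : Commute ((b * c * a * b) ^ 2) a := by
  rw [sq]; exact h.semiconj_c.mul_left h.semiconj_a

theorem commute_sq_c : Commute ((b * c * a * b) ^ 2) c := by
  rw [sq]; exact h.semiconj_a.mul_left h.semiconj_c

/-- Expresses products of single-strand twists through the squared band crossing; this is how t²
enters the pentagons. -/
theorem mul_band_right : b * c ^ 2 * b * a * (b * c ^ 2 * b) = a * (b * c * a * b) ^ 2 := by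
  calc b * c ^ 2 * b * a * (b * c ^ 2 * b) = b * c ^ 2 * (b * a * b) * c ^ 2 * b := by
        simp only [mul_assoc]
    _ = b * c * (c * a) * b * (a * c) * c * b := by rw [← h.ab]; simp only [sq, mul_assoc]
    _ = b * c * a * (c * b) * (a * c) * c * b := by rw [← h.ac.eq]; simp only [mul_assoc]
    _ = b * c * a * (c * b * c) * a * c * b := by rw [h.ac.eq]; simp only [mul_assoc]
    _ = (b * c * a * b * c) * (b * (a * c) * b) := by rw [← h.bc]; simp only [mul_assoc]
    _ = a * (b * c * a * b) * (b * c * a * b) := by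
      rw [h.semiconj_c.eq, h.ac.eq]; simp only [mul_assoc]
    _ = _ := by rw [sq, mul_assoc]

/-- Reversing the order of the generators forces the band to be trivial, which suffices for
identities not involving y. -/
theorem symm_right : Quad 1 c b a :=
  ⟨.one_left _, .one_left _, .one_left _, h.bc.symm, h.ab.symm, h.ac.symm⟩

theorem mul_band_left : b * a ^ 2 * b * c * (b * a ^ 2 * b) = c * (b * c * a * b) ^ 2 := by
  rw [h.symm_right.mul_band_right, mul_assoc b a, h.ac.eq]; simp only [mul_assoc]

theorem commute_y3_a : Commute a (b * (a * y * a) * b) := h.triple.commute_mul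

theorem commute_y3_y : Commute y (b * (a * y * a) * b) :=
  (h.yb.mul_right h.ya).mul_right h.yb

theorem mul_y_eq : a * y * a * y = y * a * y * a⁻¹ * a ^ 2 := by
  rw [← h.ya.eq]; group

theorem commute_band_left_c : Commute c (y * a * y * a⁻¹) :=
  ((h.yc.symm.mul_right h.ac.symm).mul_right h.yc.symm).mul_right h.ac.symm.inv_right

theorem commute_band_left_a : Commute a (y * a * y * a⁻¹) := by
  rw [← mul_inv_eq_iff_eq_mul.2 h.mul_y_eq]
  exact (commute_mul_of_commute h.ya).mul_right ((Commute.refl a).pow_right 2).inv_right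

theorem commute_band_left_y3 : Commute (y * a * y * a⁻¹) (b * (a * y * a) * b) :=
  ((h.commute_y3_y.mul_left h.commute_y3_a).mul_left h.commute_y3_y).mul_left
    h.commute_y3_a.inv_left

/-- The full twist on the band and two strands. -/
theorem commute_twist3 : Commute (b * (a * y * a) * b * (a * y * a * y)) a ∧
    Commute (b * (a * y * a) * b * (a * y * a * y)) b := by
  refine ⟨(h.commute_y3_a.mul_right (commute_mul_of_commute h.ya)).symm, ?_⟩
  rw [← mul_assoc]
  exact ((commute_mul_of_commute h.triple_next.zb).mul_right h.yb.symm).symm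

theorem commute_y4_a : Commute a (c * (b * (a * y * a) * b) * c) :=
  (h.ac.mul_right h.commute_y3_a).mul_right h.ac

theorem commute_y4_b : Commute b (c * (b * (a * y * a) * b) * c) := h.triple_next.commute_mul

theorem commute_y4_y : Commute y (c * (b * (a * y * a) * b) * c) :=
  (h.yc.mul_right h.commute_y3_y).mul_right h.yc

theorem commute_y3_y4 : Commute (b * (a * y * a) * b) (c * (b * (a * y * a) * b) * c) :=
  h.triple_next.commute_next

theorem commute_y4_mul_y3 :
    Commute c (c * (b * (a * y * a) * b) * c * (b * (a * y * a) * b)) :=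
  commute_mul_of_commute h.commute_y3_y4

theorem commute_twist4 :
    Commute a (c * (b * (a * y * a) * b) * c * (b * (a * y * a) * b * (a * y * a * y))) ∧
    Commute b (c * (b * (a * y * a) * b) * c * (b * (a * y * a) * b * (a * y * a * y))) ∧
    Commute c (c * (b * (a * y * a) * b) * c * (b * (a * y * a) * b * (a * y * a * y))) := by
  refine ⟨h.commute_y4_a.mul_right h.commute_twist3.1.symm,
    h.commute_y4_b.mul_right h.commute_twist3.2.symm, ?_⟩
  rw [← mul_assoc]
  exact h.commute_y4_mul_y3.mul_right
    (((h.ac.symm.mul_right h.yc.symm).mul_right h.ac.symm).mul_right h.yc.symm)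

/-- The full twist on the last four strands. -/
theorem commute_full_twist :
    Commute a (a * (b * c ^ 2 * b) * a * (b * c ^ 2 * b * c ^ 2)) ∧
    Commute b (a * (b * c ^ 2 * b) * a * (b * c ^ 2 * b * c ^ 2)) ∧
    Commute c (a * (b * c ^ 2 * b) * a * (b * c ^ 2 * b * c ^ 2)) := by
  have hN := commute_mul_sq_mul h.bc
  refine ⟨?_, h.triple_right.commute_mul.mul_right (commute_mul_of_commute h.triple_right.zb),
    ((h.ac.symm.mul_right hN).mul_right h.ac.symm).mul_right
      (hN.mul_right ((Commute.refl c).pow_right 2))⟩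
  rw [← mul_assoc]
  exact (commute_mul_of_commute h.triple_right.commute_next).mul_right (h.ac.pow_right 2)

theorem full_twist_eq : a * (b * c ^ 2 * b) * a * (b * c ^ 2 * b * c ^ 2) =
    a ^ 2 * (b * c * a * b) ^ 2 * c ^ 2 := by
  rw [sq a, mul_assoc a a, ← h.mul_band_right]; simp only [mul_assoc]

theorem mul_strand_eq : a * (b * c ^ 2 * b) * a * (c * b ^ 2 * c) =
    a * (b * c ^ 2 * b) * a * (b * c ^ 2 * b * c ^ 2) * (b ^ 2)⁻¹ := by
  rw [garside_sq h.bc, mul_assoc _ _ (b ^ 2)⁻¹, mul_inv_cancel_right]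

theorem cross_left_eq : a * b * (y * a * y * a⁻¹) * (b * a) =
    (a * y * a) * b * (a * y * a) * b⁻¹ := by
  have h1 : a⁻¹ * (b * a) = b * a * b⁻¹ := by
    rw [inv_mul_eq_iff_eq_mul, eq_comm, ← mul_assoc, ← mul_assoc, h.ab]
    simp only [mul_assoc, mul_inv_cancel, mul_one]
  have hyb := h.yb.eq
  calc a * b * (y * a * y * a⁻¹) * (b * a) = a * (b * y) * a * (y * (a⁻¹ * (b * a))) := by
        simp only [mul_assoc]
    _ = a * y * b * a * (y * b) * a * b⁻¹ := by rw [h1, ← hyb]; simp only [mul_assoc]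
    _ = a * y * (b * a * b) * y * a * b⁻¹ := by rw [hyb]; simp only [mul_assoc]
    _ = _ := by rw [← h.ab]; simp only [mul_assoc]

theorem cross_left_eq' : b * (a * y * a) * b * (a * y * a) =
    a * b * (y * a * y * a⁻¹) * (b * a) * b ^ 2 := by
  rw [h.cross_left_eq, ← h.triple_next.zb.eq]; group

theorem commute_cross {u : G} (ha : Commute a u) (hb : Commute b u) :
    Commute (a * b * (b * a)) (u * (b ^ 2)⁻¹) := by
  have hbM : Commute b (a * b * (b * a)) := by
    simpa only [sq, mul_assoc] using commute_mul_sq_mul h.ab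
  exact ((ha.mul_left hb).mul_left (hb.mul_left ha)).mul_right (hbM.pow_left 2).symm.inv_right

theorem cross_left_mul_y : a * b * (y * a * y * a⁻¹) * (b * a) * y =
    b * (a * y * a) * b * (a * y * a * y) * (b ^ 2)⁻¹ := by
  rw [← mul_inv_eq_iff_eq_mul.2 h.cross_left_eq', mul_assoc _ (b ^ 2)⁻¹,
    ← (h.yb.pow_right 2).inv_right.eq]
  simp only [mul_assoc]

theorem commute_cross_left :
    Commute (a * b * (b * a)) (a * b * (y * a * y * a⁻¹) * (b * a) * y) := by
  rw [h.cross_left_mul_y]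
  exact h.commute_cross h.commute_twist3.1.symm h.commute_twist3.2.symm

theorem commute_cross_right :
    Commute (a * b * (b * a)) (a * (b * c ^ 2 * b) * a * (c * b ^ 2 * c)) := by
  rw [h.mul_strand_eq]
  exact h.commute_cross h.commute_full_twist.1 h.commute_full_twist.2.1

theorem semiconj_inv_sq : SemiconjBy (b * a) (b ^ 2)⁻¹ (a ^ 2)⁻¹ :=
  ((semiconjBy_of_braid h.ab).pow_right 2).inv_right

/-- Both elements are the full twist on the band and two strands, times (b²)⁻¹ and (a²)⁻¹
respectively; the twist commutes with a and b, and ba carries b to a. -/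
theorem semiconj_cross_left :
    SemiconjBy (b * a) (a * b * (y * a * y * a⁻¹) * (b * a) * y)
      (b * (a * y * a) * b * (y * a * y * a⁻¹)) := by
  have e : b * (a * y * a) * b * (y * a * y * a⁻¹) =
      b * (a * y * a) * b * (a * y * a * y) * (a ^ 2)⁻¹ := by
    rw [h.mul_y_eq, mul_assoc _ _ (a ^ 2)⁻¹, mul_inv_cancel_right]
  rw [h.cross_left_mul_y, e]
  exact (h.commute_twist3.2.symm.mul_left h.commute_twist3.1.symm).semiconjBy.mul_right
    h.semiconj_inv_sq

theorem semiconj_cross_right :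
    SemiconjBy (b * a) (a * (b * c ^ 2 * b) * a * (c * b ^ 2 * c))
      (c * (b * a ^ 2 * b) * c * (b * a ^ 2 * b)) := by
  have hta := h.commute_sq_a.symm.pow_left 2
  have htc := h.commute_sq_c.symm.pow_left 2
  have e : c * (b * a ^ 2 * b) * c * (b * a ^ 2 * b) =
      a * (b * c ^ 2 * b) * a * (b * c ^ 2 * b * c ^ 2) * (a ^ 2)⁻¹ := by
    have e1 : c * (b * a ^ 2 * b) * c * (b * a ^ 2 * b) = c ^ 2 * (b * c * a * b) ^ 2 := by
      rw [sq c, mul_assoc c c, ← h.mul_band_left]; simp only [mul_assoc]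
    rw [e1, h.full_twist_eq, eq_mul_inv_iff_mul_eq, mul_assoc (a ^ 2), ← htc.eq]
    exact ((h.ac.pow_pow 2 2).mul_right hta).symm.eq
  rw [h.mul_strand_eq, e]
  exact (h.commute_full_twist.2.1.mul_left h.commute_full_twist.1).semiconjBy.mul_right
    h.semiconj_inv_sq

end Quad

end Bands

/-! ### The image of a crossing of two bands -/

section BandAction

variable {P : ProfiniteGrp.{0}} (g : GTHat)

/-- Conjugating the three-strand formula `dr_sq_mul_ppow` back by the element e of
`Triple.dr_semiconj`. -/
theorem Triple.dr_mul_dr {z b c : P} (h : Triple z b c) :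
    dr g (b * z * b) c * dr g z b =
      ev g.f (b ^ 2) z * ev g.f (b * c ^ 2 * b * c ^ 2) (b * z * b * z) *
        (c * b * ppow (b * c ^ 2 * b) g.m) *
        (ev g.f z (b * c ^ 2 * b) * ev g.f (b * z * b) (c ^ 2)) := by
  obtain ⟨e, h1, h2, h3, h4⟩ := h.dr_semiconj g
  have h5 := (h2.mul_right h1).eq
  rw [dr_sq_mul_ppow g h.bc, mul_assoc (c * b * _), h4] at h5
  have h6 : e⁻¹ = ev g.f (b ^ 2) z * ev g.f (b * c ^ 2 * b * c ^ 2) (b * z * b * z) := by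
    rw [h3, mul_inv_rev, ev_inv, ev_inv]
  rw [← h6, mul_assoc e⁻¹]
  exact eq_inv_mul_of_mul_eq h5

theorem mul_eq_inv_mul_mul {G : Type*} [Group G] {A B C D E C' D' E' : G} (hC : C⁻¹ = C')
    (hD : D⁻¹ = D') (hE : E⁻¹ = E') (h : A * B * C * D * E = 1) : A * B = E' * D' * C' := by
  rw [← hC, ← hD, ← hE, eq_inv_of_mul_eq_one_left
    (show A * B * (C * D * E) = 1 by simpa only [mul_assoc] using h)]
  group

theorem inv_mul_inv_eq {G : Type*} [Group G] {A B C D E C' D' : G} (hC : C⁻¹ = C')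
    (hD : D⁻¹ = D') (h : A * B * C * D * E = 1) : D' * C' = E * A * B := by
  rw [← hC, ← hD, eq_inv_of_mul_eq_one_right h]; group

/-- The bookkeeping of `Quad.dr_band`: `h1`, `h2` are the two strand passages, `k1`, `k2`, `k3` the
pentagons and `hex` the hexagon. The q cancel in the middle, the C cancel across U, and Z' cancels Z
across V. -/
theorem band_assembly {G : Type*} [Group G] {D₁ D₂ D₃ p q r L V A K U B C H X Z Z' J A' T : G}
    (h32 : Commute D₂ D₃) (h1 : D₁ * D₃ = p⁻¹ * L * V * (A * q)) (h2 : D₂ * D₁ = q⁻¹ * K * U * (B * r))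
    (k1 : B * p⁻¹ = C * H * X) (k2 : A * K = Z * J * C⁻¹) (k3 : r * L = X⁻¹ * A' * Z')
    (hZ : Z' * V = V * Z⁻¹) (hC : Commute C U) (hpr : Commute p r) (hex : A' * V * J * U * H = T) :
    p * r * (D₁ * D₂ * D₃ * D₁) * (r⁻¹ * p⁻¹) = X⁻¹ * T * X := by
  calc p * r * (D₁ * D₂ * D₃ * D₁) * (r⁻¹ * p⁻¹)
      = p * r * (D₁ * (D₂ * D₃) * D₁) * (r⁻¹ * p⁻¹) := by simp only [mul_assoc]
    _ = p * r * ((D₁ * D₃) * (D₂ * D₁)) * (r⁻¹ * p⁻¹) := by rw [h32.eq]; simp only [mul_assoc]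
    _ = (r * L) * V * (A * K) * U * (B * p⁻¹) := by rw [h1, h2, hpr.eq]; group
    _ = X⁻¹ * A' * (Z' * V) * Z * J * (C⁻¹ * U) * C * H * X := by
      rw [k1, k2, k3]; simp only [mul_assoc]
    _ = X⁻¹ * (A' * V * J * U * H) * X := by rw [hZ, hC.inv_left.eq]; group
    _ = _ := by rw [hex]

namespace Quad

variable {y a b c : P} (h : Quad y a b c)
include h

/-- `pentagon_swap` for y, a, bc²b. In its last term both arguments contain a factor a², namely Y a²
and t² a², which drops out. -/
theorem pentagon_right :
    ev g.f (a * y * a) (b * c ^ 2 * b) * ev g.f (a ^ 2) y =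
      ev g.f (a * (b * c ^ 2 * b) * a) y * ev g.f (a ^ 2) (b * c ^ 2 * b) *
        ev g.f (y * a * y * a⁻¹) ((b * c * a * b) ^ 2) := by
  have hy : Commute y (b * c ^ 2 * b) := (h.yb.mul_right (h.yc.pow_right 2)).mul_right h.yb
  have hp := pentagon_swap g hy h.ya h.triple_right.commute_next
  have e1 : ev g.f (a * y * a * y) (a * (b * c ^ 2 * b) * a * (b * c ^ 2 * b)) =
      ev g.f (y * a * y * a⁻¹) ((b * c * a * b) ^ 2) := by
    have e2 : a * (b * c ^ 2 * b) * a * (b * c ^ 2 * b) = (b * c * a * b) ^ 2 * a ^ 2 := by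
      rw [(h.commute_sq_a.pow_right 2).eq, sq a, mul_assoc a a, ← h.mul_band_right]
      simp only [mul_assoc]
    have hY := h.commute_band_left_a.pow_left 2
    have hT := h.commute_sq_a.symm.pow_left 2
    have hYT : Commute (a * y * a * y) (a ^ 2) :=
      ((commute_mul_of_commute h.ya).pow_left 2).symm
    rw [e2, ev_mul_right g.f_mem hYT.symm hT, h.mul_y_eq, ev_mul_left g.f_mem hY hT]
  rw [e1] at hp
  rw [← ev_inv g (b * c ^ 2 * b), ← ev_inv g y, ← mul_inv_rev]
  symm
  refine eq_inv_of_mul_eq_one_right ?_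
  simpa only [mul_assoc] using hp

theorem pentagon_middle :
    ev g.f y (a * b ^ 2 * a) * ev g.f (b * c ^ 2 * b * c ^ 2) (b * (a * y * a) * b * (a * y * a)) =
      ev g.f (a * (b * c ^ 2 * b) * a * (c * b ^ 2 * c)) (a * b * (y * a * y * a⁻¹) * (b * a) * y) *
        ev g.f (c * b ^ 2 * c) (a * b ^ 2 * a) * ev g.f y (a * (b * c ^ 2 * b) * a) := by
  have hM : a * b * (b * a) = a * b ^ 2 * a := by simp only [sq, mul_assoc]
  have hS : a * b * c ^ 2 * (b * a) = a * (b * c ^ 2 * b) * a := by simp only [mul_assoc]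
  have hbn : Commute b (c * b ^ 2 * c) := commute_mul_sq_mul h.bc.symm
  have hyK : Commute y (a * b * (y * a * y * a⁻¹) * (b * a)) := by
    rw [h.cross_left_eq]
    exact ((h.ya.mul_right h.yb).mul_right h.ya).mul_right h.yb.inv_right
  have hK := mul_inv_eq_iff_eq_mul.2 h.cross_left_eq'
  have hbK : Commute b (a * b * (y * a * y * a⁻¹) * (b * a)) := by
    rw [← hK]
    exact (commute_mul_of_commute h.triple_next.zb).mul_right
      ((Commute.refl b).pow_right 2).inv_right
  have hk := h.commute_cross_left
  have hl : Commute (a * b * (b * a)) (a * b * c ^ 2 * (b * a) * (c * b ^ 2 * c)) := by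
    rw [hS]; exact h.commute_cross_right
  have hn : Commute (c * b ^ 2 * c) (a * b * c ^ 2 * (b * a)) := by
    rw [hS]
    have h1 : Commute c (a * (b * c ^ 2 * b) * a) :=
      (h.ac.symm.mul_right (commute_mul_sq_mul h.bc)).mul_right h.ac.symm
    exact (h1.mul_left (h.triple_right.commute_mul.pow_left 2)).mul_left h1
  -- Here u = ab, v = ba, k = yaya⁻¹, l = c², n = cb²c: the one place where the general form with u
  -- ≠ v is needed.
  have hp := pentagon g ((h.yc.mul_right (h.yb.pow_right 2)).mul_right h.yc)
    (h.commute_band_left_c.symm.pow_right 2) hyK hn hk hl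
  have e1 : ev g.f (b * c ^ 2 * b * c ^ 2) (b * (a * y * a) * b * (a * y * a)) =
      ev g.f (c * b ^ 2 * c) (a * b * (y * a * y * a⁻¹) * (b * a)) := by
    rw [garside_sq h.bc, h.cross_left_eq', ev_mul_left g.f_mem (hbn.pow_left 2)
      ((hbK.pow_left 2).mul_right (.refl _)), ev_mul_right g.f_mem (hbn.pow_left 2)
      (hbK.pow_left 2)]
  rw [hM, hS] at hp
  rw [e1]
  exact mul_eq_inv_mul_mul (ev_inv g _ _) (ev_inv g _ _) (ev_inv g _ _) hp

theorem pentagon_left :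
    ev g.f (b * (a * y * a) * b) (c ^ 2) * ev g.f (a * b ^ 2 * a * b ^ 2) (a * y * a * y) =
      ev g.f ((b * c * a * b) ^ 2) (y * a * y * a⁻¹) * ev g.f (b * a ^ 2 * b) (c ^ 2) *
        ev g.f (b * (a * y * a) * b * (y * a * y * a⁻¹))
          (c * (b * a ^ 2 * b) * c * (b * a ^ 2 * b)) := by
  obtain ⟨y3, hy3⟩ : ∃ y3, y3 = b * (a * y * a) * b := ⟨_, rfl⟩
  obtain ⟨y4, hy4⟩ : ∃ y4, y4 = c * y3 * c := ⟨_, rfl⟩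
  obtain ⟨Y, hY⟩ : ∃ Y, Y = y * a * y * a⁻¹ := ⟨_, rfl⟩
  obtain ⟨M, hM⟩ : ∃ M, M = b * a ^ 2 * b := ⟨_, rfl⟩
  have haM : Commute a M := by rw [hM]; exact commute_mul_sq_mul h.ab.symm
  have haY : Commute a Y := by rw [hY]; exact h.commute_band_left_a
  have hcY : Commute c Y := by rw [hY]; exact h.commute_band_left_c
  have hy3Y : Commute y3 Y := by rw [hY, hy3]; exact h.commute_band_left_y3.symm
  have hay3 : Commute a y3 := by rw [hy3]; exact h.commute_y3_a
  have hay4 : Commute a y4 := by rw [hy4, hy3]; exact h.commute_y4_a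
  have hby4 : Commute b y4 := by rw [hy4, hy3]; exact h.commute_y4_b
  have hyy4 : Commute y y4 := by rw [hy4, hy3]; exact h.commute_y4_y
  have hy34 : Commute y3 y4 := by rw [hy4, hy3]; exact h.commute_y3_y4
  have hYy4 : Commute Y y4 := by
    rw [hY]; exact ((hyy4.mul_left hay4).mul_left hyy4).mul_left hay4.inv_left
  have hcy43 : Commute c (y4 * y3) := by rw [hy4, hy3]; exact h.commute_y4_mul_y3
  have h43c : c * y4⁻¹ * c = y3⁻¹ := by rw [hy4]; group
  have hMy4 : Commute M y4 := by
    rw [hM]; exact (hby4.mul_left (hay4.pow_left 2)).mul_left hby4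
  have hMM : Commute M (c * M * c) := by rw [hM]; exact h.triple_left.commute_next
  have e3 : y3 * Y = b * (a * y * a) * b * (a * y * a * y) * (a ^ 2)⁻¹ := by
    rw [h.mul_y_eq, ← hy3, ← hY, ← mul_assoc, mul_inv_cancel_right]
  have e4 : y4 * (y3 * Y) = c * (b * (a * y * a) * b) * c *
      (b * (a * y * a) * b * (a * y * a * y)) * (a ^ 2)⁻¹ := by
    rw [e3, hy4, hy3]; simp only [mul_assoc]
  have hM3 : Commute M (y3 * Y) := by
    obtain ⟨h1, h2⟩ := h.commute_twist3
    rw [e3]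
    refine Commute.mul_right ?_ (haM.pow_left 2).symm.inv_right
    rw [hM]
    exact (h2.symm.mul_left (h1.symm.pow_left 2)).mul_left h2.symm
  obtain ⟨k1, k2, k3⟩ := h.commute_twist4
  have hMQ : Commute M (y4 * (y3 * Y)) := hMy4.mul_right hM3
  have hcQ : Commute c (y4 * (y3 * Y)) := by
    rw [e4]; exact k3.mul_right (h.ac.symm.pow_right 2).inv_right
  have hyQ : Commute y4 (y4 * (y3 * Y)) :=
    (Commute.refl y4).mul_right (hy34.symm.mul_right hYy4.symm)
  have hTQ : Commute ((b * c * a * b) ^ 2) (y4 * (y3 * Y)) := by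
    rw [e4]
    exact ((((k2.mul_left k3).mul_left k1).mul_left k2).pow_left 2).mul_right
      (h.commute_sq_a.pow_right 2).inv_right
  -- The inverse of y4 plays the role of a strand twist, since c y4⁻¹ c = y3⁻¹. The product y4 y3 Y
  -- is the full twist on the band and four strands times a⁻², so it can be dropped wherever it
  -- commutes with both arguments; this trades the inverses for y3 and Y in `c1` to `c4`.
  have hp := pentagon_swap g hMy4.inv_right hMM
    (by rw [h43c]; exact hy34.symm.inv_inv : Commute y4⁻¹ (c * y4⁻¹ * c))
  have c1 : ev g.f y4⁻¹ (c * M * c) = ev g.f (y3 * Y) (c * M * c * M) := by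
    rw [ev_mul_right g.f_mem hM3 hMM, ← inv_mul_cancel_left y4 (y3 * Y),
      ev_mul_left g.f_mem hyQ.symm.inv_right ((hcQ.mul_left hMQ).mul_left hcQ).symm]
  have c2 : ev g.f y3⁻¹ M = ev g.f Y M := by
    rw [← inv_mul_cancel_left y3 Y, ev_mul_left g.f_mem
      (((Commute.refl y3).mul_right hy3Y).symm.inv_right) hM3.symm]
  have c3 : ev g.f (c ^ 2) y4⁻¹ = ev g.f (c ^ 2) y3 := by
    rw [← inv_mul_cancel_left y4 y3, ev_mul_right g.f_mem (hcy43.pow_left 2).symm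
      (((Commute.refl y4).mul_right hy34.symm).symm.inv_right)]
  have c4 : ev g.f (c * M * c * M) (y3⁻¹ * y4⁻¹) = ev g.f ((b * c * a * b) ^ 2) Y := by
    have hct : Commute (c ^ 2) ((b * c * a * b) ^ 2) := h.commute_sq_c.symm.pow_left 2
    have e5 : c * M * c * M = (b * c * a * b) ^ 2 * c ^ 2 := by
      rw [← hct.eq, sq c, mul_assoc c c, ← h.mul_band_left, hM]; simp only [mul_assoc]
    have e6 : Y = y3⁻¹ * y4⁻¹ * (y4 * (y3 * Y)) := by group
    have hy3Q : Commute y3 (y4 * (y3 * Y)) :=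
      hy34.mul_right ((Commute.refl y3).mul_right hy3Y)
    have hcyy : Commute c (y3⁻¹ * y4⁻¹) := by
      rw [← mul_inv_rev]; exact hcy43.inv_right
    rw [e5, ev_mul_left g.f_mem hct (hcyy.pow_left 2)]
    conv_rhs => rw [e6]
    rw [ev_mul_right g.f_mem hTQ.symm (hy3Q.symm.inv_right.mul_right hyQ.symm.inv_right)]
  have c5 : ev g.f (a * b ^ 2 * a * b ^ 2) (a * y * a * y) = ev g.f M Y := by
    rw [garside_sq h.ab, h.mul_y_eq, ← hY, ← hM, ev_mul_left g.f_mem (haM.pow_left 2)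
      ((haY.pow_left 2).mul_right (.refl _)), ev_mul_right g.f_mem (haM.pow_left 2)
      (haY.pow_left 2)]
  rw [h43c, c1, c2, c3, c4] at hp
  rw [c5, ← hy3, ← hY, ← hM]
  exact inv_mul_inv_eq (ev_inv g _ _) (ev_inv g _ _) hp

/-- Moving ba to the left and cb to the right turns the arguments into M = ab²a, R = (cb)a²(cb)⁻¹
and r = cb²c, whose product is central among them. The hexagon leaves ba·cb = t times (a²t²)^m
a^(-2m) = t^(2m). -/
theorem hexagon_band :
    ev g.f (b * a ^ 2 * b) (c ^ 2) * (b * a) * ppow (a * b ^ 2 * a) g.m *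
      ev g.f (c * b ^ 2 * c) (a * b ^ 2 * a) * (c * b) * ppow (b * c ^ 2 * b) g.m *
        ev g.f (a ^ 2) (b * c ^ 2 * b) = ppow (b * c * a * b) g.l := by
  obtain ⟨R, hR⟩ : ∃ R, R = c * b * a ^ 2 * (c * b)⁻¹ := ⟨_, rfl⟩
  obtain ⟨M, hM⟩ : ∃ M, M = a * b ^ 2 * a := ⟨_, rfl⟩
  obtain ⟨N, hN⟩ : ∃ N, N = b * c ^ 2 * b := ⟨_, rfl⟩
  obtain ⟨r, hr⟩ : ∃ r, r = c * b ^ 2 * c := ⟨_, rfl⟩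
  obtain ⟨W, hW⟩ : ∃ W, W = a * (b * c ^ 2 * b) * a * (b * c ^ 2 * b * c ^ 2) := ⟨_, rfl⟩
  obtain ⟨wa, wb, wc⟩ := h.commute_full_twist
  rw [← hW] at wa wb wc
  have ht : SemiconjBy (b * a * (c * b)) a c := by rw [h.band_eq]; exact h.semiconj_a
  have hVR : SemiconjBy (b * a) R (c ^ 2) := by
    rw [SemiconjBy, hR, ← mul_assoc, mul_inv_eq_iff_eq_mul, mul_assoc (c ^ 2), ← (ht.pow_right 2).eq]
    simp only [mul_assoc]
  have hUR : SemiconjBy (c * b) (a ^ 2) R := by rw [SemiconjBy, hR, inv_mul_cancel_right]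
  have hVM : SemiconjBy (b * a) M (b * a ^ 2 * b) := by
    rw [SemiconjBy, hM]; simp only [sq, mul_assoc]
  have hUN : SemiconjBy (c * b) N r := by
    rw [SemiconjBy, hN, hr]; simp only [sq, mul_assoc]
  have hMR : M * R = a * (b * c ^ 2 * b) * a := by
    rw [hM, hR, ← mul_assoc, mul_inv_eq_iff_eq_mul]
    have := (ht.pow_right 2).eq
    calc a * b ^ 2 * a * (c * b * a ^ 2) = a * b * (b * a * (c * b) * a ^ 2) := by
          simp only [sq, mul_assoc]
      _ = _ := by rw [this]; simp only [sq, mul_assoc]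
  have hw : M * R * r = W * (b ^ 2)⁻¹ := by rw [hMR, hr, h.mul_strand_eq, hW]
  have hbM : Commute b M := by rw [hM]; exact commute_mul_sq_mul h.ab
  have hbr : Commute b r := by rw [hr]; exact commute_mul_sq_mul h.bc.symm
  have hwM : Commute (W * (b ^ 2)⁻¹) M := by
    refine Commute.mul_left ?_ (hbM.pow_left 2).inv_left
    rw [hM]; exact ((wa.mul_left (wb.pow_left 2)).mul_left wa).symm
  have hwr : Commute (W * (b ^ 2)⁻¹) r := by
    refine Commute.mul_left ?_ (hbr.pow_left 2).inv_left
    rw [hr]; exact ((wc.mul_left (wb.pow_left 2)).mul_left wc).symm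
  have hwR : Commute (W * (b ^ 2)⁻¹) R := by
    have : R = M⁻¹ * (W * (b ^ 2)⁻¹) * r⁻¹ := by rw [← hw]; group
    rw [this]
    exact (hwM.inv_right.mul_right (.refl _)).mul_right hwr.inv_right
  have hex := hexagon g hw hwM hwR
  have hUW : SemiconjBy (c * b) (W * (c ^ 2)⁻¹) (W * (b ^ 2)⁻¹) :=
    SemiconjBy.mul_right (wc.mul_left wb) ((semiconjBy_of_braid h.bc).pow_right 2).inv_right
  have hWt : W * (c ^ 2)⁻¹ = a ^ 2 * (b * c * a * b) ^ 2 := by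
    rw [hW, h.full_twist_eq, mul_inv_cancel_right]
  have hta : Commute (a ^ 2) ((b * c * a * b) ^ 2) := h.commute_sq_a.symm.pow_left 2
  have k1 := (semiconjBy_ev g.f hVM hVR).eq
  have k2 := (semiconjBy_ev g.f hUR hUN).eq
  have k3 := (semiconjBy_ppow g.m hUN).eq
  have k4 := (semiconjBy_ppow g.m hUR).inv_right.eq
  have k5 := (semiconjBy_ppow g.m hUW).eq
  have k6 : ppow (W * (c ^ 2)⁻¹) g.m * (ppow (a ^ 2) g.m)⁻¹ =
      ppow ((b * c * a * b) ^ 2) g.m := by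
    rw [hWt, mul_ppow hta, (ppow_comm hta _ _).eq, mul_inv_cancel_right]
  rw [← hM, ← hN, ← hr, ppow_l, ← k6, ← k1, ← h.band_eq]
  calc _ = b * a * (ev g.f M R * ppow M g.m * ev g.f r M * (c * b * ppow N g.m) *
        ev g.f (a ^ 2) N) := by simp only [mul_assoc]
    _ = b * a * ((ev g.f M R * ppow M g.m * ev g.f r M * ppow r g.m * ev g.f R r * ppow R g.m) *
        ((ppow R g.m)⁻¹ * (c * b))) := by
      rw [k3]; simp only [mul_assoc, k2, mul_inv_cancel_left]
    _ = _ := by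
      rw [hex, ← k4, ← mul_assoc _ (c * b), ← k5]; simp only [mul_assoc]

theorem dr_band :
    ev g.f y (a ^ 2) * ev g.f (b * (a * y * a) * b) (c ^ 2) *
      (dr g (a * y * a) b * dr g (b * (a * y * a) * b) c * dr g y a * dr g (a * y * a) b) *
      (ev g.f (c ^ 2) (b * (a * y * a) * b) * ev g.f (a ^ 2) y) =
    ev g.f ((b * c * a * b) ^ 2) (y * a * y * a⁻¹) * ppow (b * c * a * b) g.l *
      ev g.f (y * a * y * a⁻¹) ((b * c * a * b) ^ 2) := by
  have h1 := h.triple.dr_mul_dr g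
  have h2 := h.triple_next.dr_mul_dr g
  have k1 := h.pentagon_right g
  have k2 := h.pentagon_middle g
  have k3 := h.pentagon_left g
  have hex := h.hexagon_band g
  have h32 : Commute (dr g (b * (a * y * a) * b) c) (dr g y a) :=
    commute_dr g (commute_dr g h.commute_y3_y h.yc).symm (commute_dr g h.commute_y3_a h.ac).symm
  have hpr : Commute (ev g.f y (a ^ 2)) (ev g.f (b * (a * y * a) * b) (c ^ 2)) :=
    commute_ev_ev _ _ h.commute_y3_y (h.yc.pow_right 2) (h.commute_y3_a.pow_left 2)
      (h.ac.pow_pow 2 2)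
  rw [← ev_inv g y (a ^ 2), ← ev_inv g (b * (a * y * a) * b) (c ^ 2),
    ← ev_inv g (y * a * y * a⁻¹) ((b * c * a * b) ^ 2)]
  have hC : Commute (ev g.f (a * (b * c ^ 2 * b) * a) y)
      (c * b * ppow (b * c ^ 2 * b) g.m) := by
    have hN := commute_mul_sq_mul h.bc
    have h3 : Commute (c * b) (a * (b * c ^ 2 * b) * a) :=
      ((h.ac.symm.mul_right hN).mul_right h.ac.symm).mul_left h.triple_right.commute_mul
    have h4 : Commute (c * b) y := (h.yc.mul_right h.yb).symm
    have h5 : Commute (b * c ^ 2 * b) y :=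
      ((h.yb.mul_right (h.yc.pow_right 2)).mul_right h.yb).symm
    exact (commute_ev _ h3 h4).symm.mul_right
      (commute_ev _ (commute_ppow _ h.triple_right.commute_next.symm).symm
        (commute_ppow _ h5.symm).symm).symm
  have hM : a * b * (b * a) = a * b ^ 2 * a := by simp only [sq, mul_assoc]
  have hZ : ev g.f (b * (a * y * a) * b * (y * a * y * a⁻¹))
        (c * (b * a ^ 2 * b) * c * (b * a ^ 2 * b)) * (b * a * ppow (a * b ^ 2 * a) g.m) =
      b * a * ppow (a * b ^ 2 * a) g.m *
        (ev g.f (a * (b * c ^ 2 * b) * a * (c * b ^ 2 * c))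
          (a * b * (y * a * y * a⁻¹) * (b * a) * y))⁻¹ := by
    have hMZ := commute_ev g.f h.commute_cross_left h.commute_cross_right
    rw [hM] at hMZ
    rw [← mul_assoc, ← (semiconjBy_ev g.f h.semiconj_cross_left h.semiconj_cross_right).eq, ev_inv,
      mul_assoc, (commute_ppow g.m hMZ.symm).eq, ← mul_assoc]
  rw [← ev_inv g y (a ^ 2)] at h1 k1
  rw [← ev_inv g (a * y * a) (b ^ 2)] at h2
  rw [← ev_inv g (a * (b * c ^ 2 * b) * a) y] at k2
  rw [← ev_inv g (y * a * y * a⁻¹) ((b * c * a * b) ^ 2)] at k3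
  exact band_assembly h32 h1 h2 k1 k2 k3 hZ hC hpr (by rw [← hex]; simp only [mul_assoc])

end Quad
end BandAction

/-! ### Sequences satisfying the braid relations -/

section BraidSequence

variable {G : Type*} [Group G]

/-- The elements `s 1, …, s K` satisfy the braid relations. -/
structure IsBraidSeq (s : ℕ → G) (K : ℕ) : Prop where
  braid : ∀ i, 1 ≤ i → i + 1 ≤ K → s i * s (i + 1) * s i = s (i + 1) * s i * s (i + 1)
  comm : ∀ i j, 1 ≤ i → i + 1 < j → j ≤ K → Commute (s i) (s j)

/-- The product `s 1 * ⋯ * s k`. -/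
def ascProd (s : ℕ → G) (k : ℕ) : G := ((List.range k).map fun j => s (j + 1)).prod

theorem ascProd_succ (s : ℕ → G) (k : ℕ) : ascProd s (k + 1) = ascProd s k * s (k + 1) := by
  simp [ascProd, List.range_succ]

theorem commute_ascProd {s : ℕ → G} {u : G} {k : ℕ} (h : ∀ j, 1 ≤ j → j ≤ k → Commute u (s j)) :
    Commute u (ascProd s k) := by
  induction k with
  | zero => exact .one_right _
  | succ k ih =>
    rw [ascProd_succ]
    exact (ih fun j h1 h2 => h j h1 (by omega)).mul_right (h _ (by omega) le_rfl)

/-- The product `s k * s (k - 1) * ⋯` of `r` factors. -/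
def descProd (s : ℕ → G) : ℕ → ℕ → G
  | _, 0 => 1
  | 0, _ + 1 => 1
  | k + 1, r + 1 => s (k + 1) * descProd s k r

namespace IsBraidSeq

variable {s : ℕ → G} {K : ℕ} (h : IsBraidSeq s K)
include h

theorem semiconjBy_ascProd {j k : ℕ} (hj : 1 ≤ j) (hjk : j < k) (hk : k ≤ K) :
    SemiconjBy (ascProd s k) (s j) (s (j + 1)) := by
  induction k with
  | zero => omega
  | succ k ih =>
    rw [ascProd_succ]
    rcases Nat.lt_or_ge j k with hlt | hge
    · exact (ih hlt (by omega)).mul_left (h.comm j (k + 1) hj (by omega) hk).symm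
    · obtain rfl : j = k := by omega
      obtain ⟨i, rfl⟩ := Nat.exists_eq_add_of_le' hj
      have hc : Commute (s (i + 1 + 1)) (ascProd s i) :=
        commute_ascProd fun m h1 h2 => (h.comm m _ h1 (by omega) hk).symm
      have hb := h.braid (i + 1) hj hk
      rw [ascProd_succ, mul_assoc]
      refine SemiconjBy.mul_left (y := s (i + 1 + 1)) hc.symm ?_
      rw [SemiconjBy, hb, mul_assoc]

theorem semiconjBy_descProd {k r : ℕ} (hr : r < k) (hk : k ≤ K) :
    descProd s k r * ascProd s k = ascProd s k * descProd s (k - 1) r := by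
  have key : ∀ j r, r ≤ j → j < k →
      SemiconjBy (ascProd s k) (descProd s j r) (descProd s (j + 1) r) := by
    intro j
    induction j with
    | zero =>
      intro r hr _
      obtain rfl : r = 0 := by omega
      exact SemiconjBy.one_right _
    | succ j ih =>
      intro r hr hj
      cases r with
      | zero => exact SemiconjBy.one_right _
      | succ r =>
        exact (h.semiconjBy_ascProd (by omega) hj hk).mul_right (ih r (by omega) (by omega))
  obtain ⟨k, rfl⟩ := Nat.exists_eq_add_of_le' (show 1 ≤ k by omega)
  exact (key k r (by omega) (by omega)).eq.symm

/-- Each new factor s_1⋯s_k is moved left past the collected descending product, whose indices it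
lowers by one. -/
theorem ascProd_pow {k r : ℕ} (hr : r ≤ k + 1) (hk : k + 1 ≤ K) :
    ascProd s (k + 1) ^ r = ascProd s k ^ r * descProd s (k + 1) r := by
  induction r with
  | zero => simp [descProd]
  | succ r ih =>
    rw [pow_succ, ih (by omega), mul_assoc, h.semiconjBy_descProd (by omega) hk, ascProd_succ,
      Nat.add_sub_cancel, mul_assoc (ascProd s k), ← mul_assoc, ← pow_succ]
    rfl

/-- A full twist is the full twist on one strand fewer times the twist of the last strand around the
others; only the recursion for Y is used, so it applies to bands. -/
theorem ascProd_pow_succ {Y : ℕ → G} (hY1 : Y 1 = 1)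
    (hY : ∀ k, 1 ≤ k → k ≤ K → s k * Y k * s k = Y (k + 1)) {k : ℕ} (hk : k + 1 ≤ K) :
    ascProd s (k + 1) ^ (k + 2) = ascProd s k ^ (k + 1) * Y (k + 2) := by
  have key : ∀ m ≤ K, descProd s m m * ascProd s m = Y (m + 1) := by
    intro m hm
    induction m with
    | zero => simp [descProd, ascProd, hY1]
    | succ m ih =>
      rw [ascProd_succ, ← hY (m + 1) (by omega) hm, ← ih (by omega), descProd]
      simp only [mul_assoc]
  rw [pow_succ, h.ascProd_pow le_rfl hk, mul_assoc, key _ hk]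

end IsBraidSeq

end BraidSequence

/-! ### The elements `t` and `W` -/

section Cabling

variable {n : ℕ}

theorem quad {i : ℕ} (h1 : 1 ≤ i) (hi : i + 2 < n) :
    Quad (y n i) (a n i) (a n (i + 1)) (a n (i + 2)) :=
  ⟨y_comm_mul h1 (by omega), y_comm_a (by omega), y_comm_a (by omega), a_braid h1 (by omega),
    a_braid (by omega) hi, a_comm (by omega)⟩

theorem t_eq (i : ℕ) :
    t n (i + 1) = a n (2 * i + 2) * a n (2 * i + 3) * a n (2 * i + 1) * a n (2 * i + 2) := rfl

theorem commute_t {u : BraidHat n} {i : ℕ} (h : ∀ j, 2 * i + 1 ≤ j → j ≤ 2 * i + 3 →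
    Commute u (a n j)) : Commute u (t n (i + 1)) := by
  rw [t_eq]
  have h2 := h (2 * i + 2) (by omega) (by omega)
  exact ((h2.mul_right (h _ (by omega) le_rfl)).mul_right (h _ le_rfl (by omega))).mul_right h2

theorem isBraidSeq_a (p : ℕ) {K : ℕ} (hK : p + K < n) :
    IsBraidSeq (fun j => a n (p + j)) K :=
  ⟨fun i _ _ => a_braid (by omega) (by omega), fun i j _ _ _ => a_comm (by omega)⟩

theorem t_mul_t_eq (p : ℕ) : t n (p + 1) * t n (p + 2) =
    ascProd (fun j => a n (2 * p + 1 + j)) 4 * ascProd (fun j => a n (2 * p + j)) 4 := by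
  have h24 : Commute (a n (2 * p + 2)) (a n (2 * p + 4)) := a_comm (by omega)
  have h25 : Commute (a n (2 * p + 2)) (a n (2 * p + 5)) := a_comm (by omega)
  have h14 : Commute (a n (2 * p + 1)) (a n (2 * p + 4)) := a_comm (by omega)
  have h15 : Commute (a n (2 * p + 1)) (a n (2 * p + 5)) := a_comm (by omega)
  have hc := (h14.mul_right h15).mul_left (h24.mul_right h25)
  calc t n (p + 1) * t n (p + 2)
      = a n (2 * p + 2) * a n (2 * p + 3) * ((a n (2 * p + 1) * a n (2 * p + 2)) *
        (a n (2 * p + 4) * a n (2 * p + 5))) * (a n (2 * p + 3) * a n (2 * p + 4)) := by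
        rw [t_eq, t_eq]; simp only [mul_assoc]; rfl
    _ = _ := by
      rw [hc.eq]
      simp [ascProd, List.range_succ, mul_assoc, add_assoc]

/-- By `t_mul_t_eq` the product is two ascending products of four generators, each shifting indices
by one under conjugation; together they carry t_{p+1} to t_{p+2}. -/
theorem t_braid (p : ℕ) (hp : 2 * p + 5 < n) :
    t n (p + 1) * t n (p + 2) * t n (p + 1) = t n (p + 2) * t n (p + 1) * t n (p + 2) := by
  have key : ∀ j, 1 ≤ j → j ≤ 3 →
      SemiconjBy (t n (p + 1) * t n (p + 2)) (a n (2 * p + j)) (a n (2 * p + j + 2)) := by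
    intro j h1 h3
    rw [t_mul_t_eq]
    have e1 := (isBraidSeq_a (n := n) (2 * p) (K := 4) (by omega)).semiconjBy_ascProd
      (j := j) (k := 4) h1 (by omega) le_rfl
    have e2 := (isBraidSeq_a (n := n) (2 * p + 1) (K := 4) (by omega)).semiconjBy_ascProd
      (j := j) (k := 4) h1 (by omega) le_rfl
    have : 2 * p + 1 + j = 2 * p + (j + 1) := by omega
    simp only [this] at e2
    have h2 : 2 * p + 1 + (j + 1) = 2 * p + j + 2 := by omega
    rw [h2] at e2
    exact e2.mul_left e1
  have h : SemiconjBy (t n (p + 1) * t n (p + 2)) (t n (p + 1)) (t n (p + 2)) :=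
    (((key 2 (by omega) (by omega)).mul_right (key 3 (by omega) le_rfl)).mul_right
      (key 1 le_rfl (by omega))).mul_right (key 2 (by omega) (by omega))
  rw [h.eq, mul_assoc]

theorem isBraidSeq_t {K : ℕ} (hK : 2 * K + 1 < n) : IsBraidSeq (t n) K := by
  constructor
  · intro i h1 hi
    obtain ⟨i, rfl⟩ := Nat.exists_eq_add_of_le' h1
    exact t_braid i (by omega)
  · intro i j h1 hij _
    obtain ⟨i, rfl⟩ := Nat.exists_eq_add_of_le' h1
    obtain ⟨j, rfl⟩ := Nat.exists_eq_add_of_le' (show 1 ≤ j by omega)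
    exact commute_t fun m _ _ => (commute_t fun k _ _ => (a_comm (by omega)).symm).symm

theorem Quad.band_next {G : Type*} [Group G] {y a b c : G} (h : Quad y a b c) :
    (b * c * a * b) * (y * a * y * a⁻¹) * (b * c * a * b) =
      (b * (a * y * a) * b) * c * (b * (a * y * a) * b) * c⁻¹ := by
  have hac := h.ac.eq
  have hyb := h.yb.eq
  have hc : Commute c (a * y * a) := (h.ac.symm.mul_right h.yc.symm).mul_right h.ac.symm
  have e1 : a⁻¹ * (b * c * a * b) = b * c * a * b * c⁻¹ := by
    rw [inv_mul_eq_iff_eq_mul, ← mul_assoc, ← h.semiconj_c.eq, mul_inv_cancel_right]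
  calc (b * c * a * b) * (y * a * y * a⁻¹) * (b * c * a * b)
      = b * c * a * b * (y * a * y) * (a⁻¹ * (b * c * a * b)) := by simp only [mul_assoc]
    _ = b * c * a * (b * y) * a * y * b * (c * a) * b * c⁻¹ := by rw [e1]; simp only [mul_assoc]
    _ = b * c * a * y * (b * a) * (y * b) * a * c * b * c⁻¹ := by
      rw [← hyb, ← hac]; simp only [mul_assoc]
    _ = b * c * a * y * (b * a * b) * y * a * c * b * c⁻¹ := by rw [hyb]; simp only [mul_assoc]
    _ = b * (c * (a * y * a)) * b * ((a * y * a) * c) * b * c⁻¹ := by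
      rw [← h.ab]; simp only [mul_assoc]
    _ = b * (a * y * a) * (c * b) * ((a * y * a) * c) * b * c⁻¹ := by
      rw [hc.eq]; simp only [mul_assoc]
    _ = b * (a * y * a) * (c * b * c) * (a * y * a) * b * c⁻¹ := by
      rw [← hc.eq]; simp only [mul_assoc]
    _ = _ := by rw [← h.bc]; simp only [mul_assoc]

/-- The full twist of the `k`-th band of two strands around the preceding strands. -/
def bandTwist (n k : ℕ) : BraidHat n :=
  y n (2 * k - 1) * a n (2 * k - 1) * y n (2 * k - 1) * (a n (2 * k - 1))⁻¹

theorem bandTwist_one : bandTwist n 1 = 1 := by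
  have : y n 1 = 1 := rfl
  simp [bandTwist, this]

theorem t_mul_bandTwist_mul_t {k : ℕ} (h1 : 1 ≤ k) (hk : 2 * k + 1 < n) :
    t n k * bandTwist n k * t n k = bandTwist n (k + 1) := by
  obtain ⟨k, rfl⟩ := Nat.exists_eq_add_of_le' h1
  have h := (quad (n := n) (i := 2 * k + 1) (by omega) (by omega)).band_next
  rw [← y_succ (by omega), ← y_succ (by omega)] at h
  exact h

theorem W_eq (i : ℕ) : W n (i + 1) = ascProd (t n) i ^ (i + 1) := rfl

theorem W_succ {i : ℕ} (hi : 2 * i + 3 < n) :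
    W n (i + 2) = W n (i + 1) * bandTwist n (i + 2) := by
  rw [W_eq, W_eq]
  exact (isBraidSeq_t (n := n) (K := i + 1) (by omega)).ascProd_pow_succ bandTwist_one
    (fun k h1 h2 => t_mul_bandTwist_mul_t h1 (by omega)) le_rfl

theorem commute_W {u : BraidHat n} {i : ℕ} (h : ∀ j, 1 ≤ j → j ≤ 2 * i + 1 → Commute u (a n j)) :
    Commute u (W n (i + 1)) := by
  rw [W_eq]
  refine Commute.pow_right (commute_ascProd fun j h1 h2 => ?_) _
  obtain ⟨j, rfl⟩ := Nat.exists_eq_add_of_le' h1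
  exact commute_t fun k h3 h4 => h k (by omega) (by omega)

/-- The twist of the earlier bands among themselves commutes with t and with the twist of the
current band, so f ignores it. -/
theorem ev_sq_W (g : GTHat) {i : ℕ} (hi : 2 * i + 5 < n) :
    ev g.f (t n (i + 2) ^ 2) (W n (i + 2)) = ev g.f (t n (i + 2) ^ 2) (bandTwist n (i + 2)) := by
  have ha : ∀ k, 2 * i + 3 ≤ k → Commute (W n (i + 1)) (a n k) := fun k hk =>
    (commute_W fun j _ _ => (a_comm (by omega)).symm).symm
  have hy : Commute (W n (i + 1)) (y n (2 * i + 3)) :=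
    (commute_W fun j h1 h2 => (a_comm_y h1 (by omega) (by omega)).symm).symm
  have h1 : Commute (W n (i + 1)) (t n (i + 2)) := commute_t fun j h1 _ => ha j (by omega)
  have h2 : Commute (W n (i + 1)) (bandTwist n (i + 2)) :=
    ((hy.mul_right (ha _ le_rfl)).mul_right hy).mul_right (ha _ le_rfl).inv_right
  rw [W_succ (by omega), h2.eq, ev_mul_right g.f_mem (h1.pow_right 2) h2]

end Cabling

/-! ### The conjugated action on the elements `t` -/

section ConjugatedAction

variable (g : GTHat) {n : ℕ}

/-- The factors of `twistProd`, indexed so that the factor of index `0` is trivial. -/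
def twistFactor (n k : ℕ) : BraidHat n := ev g.f (y n (2 * k + 1)) (a n (2 * k + 1) ^ 2)

theorem twistFactor_zero : twistFactor g n 0 = 1 := ev_eq_one g.f_mem (.one_left _)

theorem twistFactor_inv (k : ℕ) :
    (twistFactor g n k)⁻¹ = ev g.f (a n (2 * k + 1) ^ 2) (y n (2 * k + 1)) := ev_inv ..

/-- The product of the first `m` factors. -/
def twistPartial (n m : ℕ) : BraidHat n := ((List.range m).map (twistFactor g n)).prod

theorem twistPartial_succ (m : ℕ) :
    twistPartial g n (m + 1) = twistPartial g n m * twistFactor g n m := by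
  simp [twistPartial, List.range_succ]

theorem twistProd_eq (hn : 2 ≤ n) : twistProd g n = twistPartial g n (n / 2) := by
  obtain ⟨m, hm⟩ := Nat.exists_eq_add_of_le' (show 1 ≤ n / 2 by omega)
  rw [twistProd, twistPartial, hm, Nat.add_sub_cancel, List.range_succ_eq_map, List.map_cons,
    List.prod_cons, twistFactor_zero, one_mul, List.map_map]
  rfl

theorem commute_twistFactor_a {k j : ℕ} (hj : 1 ≤ j) (hjk : j + 1 < 2 * k + 1)
    (hk : 2 * k + 1 ≤ n) : Commute (twistFactor g n k) (a n j) :=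
  (commute_ev _ (a_comm_y hj (by omega) hk) ((a_comm hjk).pow_right 2)).symm

theorem commute_twistPartial {u : BraidHat n} {m : ℕ}
    (hy : ∀ k < m, Commute u (y n (2 * k + 1))) (ha : ∀ k < m, Commute u (a n (2 * k + 1))) :
    Commute u (twistPartial g n m) := by
  induction m with
  | zero => exact .one_right _
  | succ m ih =>
    rw [twistPartial_succ]
    exact (ih (fun k hk => hy k (by omega)) fun k hk => ha k (by omega)).mul_right
      (commute_ev _ (hy m (by omega)) ((ha m (by omega)).pow_right 2))

/-- The value of the conjugated action on `t`, in terms of the twist of a single band. -/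
def bandImage (n i : ℕ) : BraidHat n :=
  ev g.f (t n i ^ 2) (bandTwist n i) * ppow (t n i) g.l * ev g.f (bandTwist n i) (t n i ^ 2)

theorem commute_bandImage {u : BraidHat n} {i : ℕ} (hy : Commute u (y n (2 * i + 1)))
    (ha : ∀ j, 2 * i + 1 ≤ j → j ≤ 2 * i + 3 → Commute u (a n j)) :
    Commute u (bandImage g n (i + 1)) := by
  have ht : Commute u (t n (i + 1)) := commute_t ha
  have h1 := ha (2 * i + 1) le_rfl (by omega)
  have hb : Commute u (bandTwist n (i + 1)) :=
    ((hy.mul_right h1).mul_right hy).mul_right h1.inv_right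
  exact ((commute_ev _ (ht.pow_right 2) hb).mul_right (commute_ppow _ ht)).mul_right
    (commute_ev _ hb (ht.pow_right 2))

variable {F : BraidHat n ≃ₜ* BraidHat n}

/-- Only the factors of index i and i+1 matter: later ones commute with F(t_{i+1}), earlier ones
with the resulting band formula. -/
theorem conj_twistPartial (hF : ∀ i, 1 ≤ i → i < n → F (a n i) = dr g (y n i) (a n i))
    {i m : ℕ} (him : i + 2 ≤ m) (hm : 2 * m ≤ n) :
    twistPartial g n m * F (t n (i + 1)) * (twistPartial g n m)⁻¹ = bandImage g n (i + 1) := by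
  have hX : F (t n (i + 1)) = dr g (y n (2 * i + 2)) (a n (2 * i + 2)) *
      dr g (y n (2 * i + 3)) (a n (2 * i + 3)) * dr g (y n (2 * i + 1)) (a n (2 * i + 1)) *
      dr g (y n (2 * i + 2)) (a n (2 * i + 2)) := by
    rw [t_eq, map_mul, map_mul, map_mul, hF _ (by omega) (by omega), hF _ (by omega) (by omega),
      hF _ (by omega) (by omega)]
  induction m, him using Nat.le_induction with
  -- With m = i + 2 the last two factors are exactly the conjugating pair of `Quad.dr_band`; for i =
  -- 0 the first of them is trivial because y_1 = 1.
  | base =>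
    have hq := (quad (n := n) (i := 2 * i + 1) (by omega) (by omega)).dr_band g
    rw [← y_succ (by omega), ← y_succ (by omega)] at hq
    have hC : twistFactor g n i * twistFactor g n (i + 1) * F (t n (i + 1)) *
        ((twistFactor g n (i + 1))⁻¹ * (twistFactor g n i)⁻¹) = bandImage g n (i + 1) := by
      rw [hX, twistFactor_inv, twistFactor_inv]
      exact hq
    have hP : Commute (bandImage g n (i + 1)) (twistPartial g n i) := by
      refine commute_twistPartial g (fun k hk => ?_) fun k hk => ?_
      · exact (commute_bandImage g (y_comm_y (by omega) (by omega))
          fun j _ _ => y_comm_a (by omega)).symm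
      · exact (commute_bandImage g (a_comm_y (by omega) (by omega) (by omega))
          fun j _ _ => a_comm (by omega)).symm
    calc _ = twistPartial g n i * (twistFactor g n i * twistFactor g n (i + 1) * F (t n (i + 1)) *
          ((twistFactor g n (i + 1))⁻¹ * (twistFactor g n i)⁻¹)) * (twistPartial g n i)⁻¹ := by
          rw [twistPartial_succ, twistPartial_succ]; group
      _ = _ := by rw [hC, ← hP.eq, mul_inv_cancel_right]
  | succ m him ih =>
    have ha : ∀ j, 1 ≤ j → j ≤ 2 * i + 3 → Commute (twistFactor g n m) (a n j) :=
      fun j h1 _ => commute_twistFactor_a g h1 (by omega) (by omega)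
    have hd : ∀ j, 1 ≤ j → j ≤ 2 * i + 3 → Commute (twistFactor g n m) (dr g (y n j) (a n j)) :=
      fun j h1 h2 => commute_dr g (commute_y_of_forall fun k h3 _ => ha k h3 (by omega)) (ha j h1 h2)
    have hc : Commute (twistFactor g n m) (F (t n (i + 1))) := by
      rw [hX]
      exact (((hd _ (by omega) (by omega)).mul_right (hd _ (by omega) (by omega))).mul_right
        (hd _ (by omega) (by omega))).mul_right (hd _ (by omega) (by omega))
    rw [← ih (by omega), twistPartial_succ, mul_inv_rev, mul_assoc (twistPartial g n m), hc.eq]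
    group

theorem FB_t (hF : IsDrinfeldAction g n F) {i : ℕ} (hi : 2 * i + 4 ≤ n) :
    FB g n F (t n (i + 1)) = bandImage g n (i + 1) := by
  change twistProd g n * F (t n (i + 1)) * (twistProd g n)⁻¹ = _
  rw [twistProd_eq g (by omega)]
  exact conj_twistPartial g ((isDrinfeldAction_iff g (by omega) F).1 hF) (by omega) (by omega)

theorem FB_t_one (hF : IsDrinfeldAction g n F) (hn : 4 ≤ n) :
    FB g n F (t n 1) = ppow (t n 1) g.l := by
  rw [FB_t g hF (i := 0) hn, bandImage, bandTwist_one, ev_eq_one g.f_mem (.one_right _),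
    ev_eq_one g.f_mem (.one_left _), one_mul, mul_one]

theorem FB_t_of_two_le (hF : IsDrinfeldAction g n F) {i : ℕ} (h2 : 2 ≤ i) (hi : 2 * i + 2 ≤ n) :
    FB g n F (t n i) =
      ev g.f (t n i ^ 2) (W n i) * ppow (t n i) g.l * ev g.f (W n i) (t n i ^ 2) := by
  obtain ⟨i, rfl⟩ := Nat.exists_eq_add_of_le' h2
  rw [FB_t g hF (i := i + 1) (by omega), bandImage, ← ev_inv g _ (W n (i + 2)),
    ev_sq_W g (by omega), ev_inv]

theorem W_two : W n 2 = t n 1 ^ 2 := by simp [W]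

end ConjugatedAction

end GTBraid

end

theorem mainTheorem5 (g : GTBraid.GTHat) (n : ℕ) (hn : 4 ≤ n) :
    (∃! F : GTBraid.BraidHat n ≃ₜ* GTBraid.BraidHat n, GTBraid.IsDrinfeldAction g n F) ∧
    ∀ F : GTBraid.BraidHat n ≃ₜ* GTBraid.BraidHat n, GTBraid.IsDrinfeldAction g n F →
      GTBraid.FB g n F (GTBraid.t n 1) = GTBraid.ppow (GTBraid.t n 1) g.l ∧
      (6 ≤ n → GTBraid.FB g n F (GTBraid.t n 2) =
        GTBraid.ev g.f (GTBraid.t n 2 ^ 2) (GTBraid.t n 1 ^ 2) *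
          GTBraid.ppow (GTBraid.t n 2) g.l *
          GTBraid.ev g.f (GTBraid.t n 1 ^ 2) (GTBraid.t n 2 ^ 2)) ∧
      ∀ i : ℕ, 2 ≤ i → 2 * i + 2 ≤ n →
        GTBraid.FB g n F (GTBraid.t n i) =
          GTBraid.ev g.f (GTBraid.t n i ^ 2) (GTBraid.W n i) *
            GTBraid.ppow (GTBraid.t n i) g.l *
            GTBraid.ev g.f (GTBraid.W n i) (GTBraid.t n i ^ 2) := by
  refine ⟨GTBraid.existsUnique_isDrinfeldAction g (by omega), fun F hF =>
    ⟨GTBraid.FB_t_one g hF hn, fun h6 => ?_, fun i => GTBraid.FB_t_of_two_le g hF⟩⟩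
  rw [← GTBraid.W_two]
  exact GTBraid.FB_t_of_two_le g hF le_rfl h6
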